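/- Let $n\ge 2$ be an integer and let $(z,w)=(z_1,\dots,z_n,w_1,\dots,w_n)$ be the coordinates of $\mathbb C^{2n}\simeq\mathbb R^{4n}$, identified with $\mathbb H^n$ by $h=z+jw$ (quaternions are written $q=a+jb$ with $a,b\in\mathbb C$, $j^2=-1$, $ja=\bar a j$). Let $\mathcal H^k$ be the complex vector space of complex-valued harmonic polynomial functions on $\mathbb R^{4n}$ that are homogeneous of degree $k$. Let $Sp(n)=U(2n)\cap Sp(2n,\mathbb C)$ be the group of unitary matrices of the form $\begin{pmatrix}A&-\overline B\\ B&\overline A\end{pmatrix}$ (that is, of linear isometries $A+jB$ of $\mathbb H^n$), acting on functions on the left by $L(u)f(x)=f(u^{-1}x)$, and let $1\times Sp(n-1)\subset Sp(n)$ be the subgroup of quaternionic matrices $\begin{pmatrix}1&0\\0&A\end{pmatrix}$, $A\in Sp(n-1)$. The group $Sp(1)$ of unit quaternions $q=a+jb$ acts on functions on the right by $R(q)f(h)=f(hq)$, that is, $R(q)f(z,w)=f(az-b\overline w,\,aw+b\overline z)$. For $\alpha,\beta,\gamma\in\mathbb N$ with $\gamma\le\min(\alpha,\beta)$, let $V_\gamma^{\alpha,\beta}$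 be the $Sp(n)$-invariant subspace, for the left action, generated by the highest weight vector $$P_\gamma^{\alpha,\beta}=w_1^{\alpha-\gamma}\,\overline{z_1}^{\,\beta-\gamma}\,(w_2\overline{z_1}-w_1\overline{z_2})^{\gamma}.$$ A polynomial of $\mathcal H^k$ is called bi-invariant if it is invariant under the left action of $1\times Sp(n-1)$ and under the right action of $Sp(1)$. Then: 1. For all $\alpha,\beta,\gamma\in\mathbb N$ with $\gamma\le\min(\alpha,\beta)$, the complex vector space $\mathrm{Inv}_\gamma^{\alpha,\beta}$ of all elements of $V_\gamma^{\alpha,\beta}$ that are invariant under the left action of $1\times Sp(n-1)$ satisfies $$\dim_{\mathbb C}\mathrm{Inv}_\gamma^{\alpha,\beta}=\alpha+\beta-2\gamma+1.$$ This dimension is at least $1$, and it equals $1$ if and only if $\alpha=\beta=\gamma$. 2. Let $k\in\mathbb N$. If $\mathcal H^k$ contains a nonzero bi-invariant polynomial, then $k$ is even. Conversely, if $k$ is even and $\alpha=k/2$, then $\mathcal H^k$ contains a nonzero bi-invariant polynomial, it is unique up to a scalar factor, and it belongs to $V_\alpha^{\alpha,\alpha}$. -/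

import Mathlib

open scoped Matrix

namespace QuatHarm

noncomputable section

/-- Index set of the coordinates of `ℂ²ⁿ`: `inl r` is the index of `z_r`, `inr r` that of `w_r`. -/
abbrev Idx (n : ℕ) : Type := Fin n ⊕ Fin n

/-- `ℂ²ⁿ`, with points written `(z, w)`; it is identified with `ℍⁿ` through `h = z + j w`. -/
abbrev CSpace (n : ℕ) : Type := Idx n → ℂ

/-- Polynomials with complex coefficients in the `4n` variables `z_r, w_r` (variables `inl i`) and
`conj z_r, conj w_r` (variables `inr i`). -/
abbrev ConjPoly (n : ℕ) : Type := MvPolynomial (Idx n ⊕ Idx n) ℂ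

/-- The polynomial function on `ℂ²ⁿ = ℝ⁴ⁿ` defined by a polynomial in the coordinates and their
complex conjugates. -/
def toFunction (n : ℕ) : ConjPoly n →ₗ[ℂ] (CSpace n → ℂ) :=
  LinearMap.pi fun x =>
    (MvPolynomial.aeval (Sum.elim x (star x) : Idx n ⊕ Idx n → ℂ)).toLinearMap

/-- The Laplace operator `4 ∑ ∂² / ∂ζ_i ∂(conj ζ_i)`, where `ζ` runs through the `2n` complex
coordinates. -/
def laplace (n : ℕ) : ConjPoly n →ₗ[ℂ] ConjPoly n :=
  (4 : ℂ) • ∑ i : Idx n,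
    (MvPolynomial.pderiv (Sum.inl i)).toLinearMap ∘ₗ (MvPolynomial.pderiv (Sum.inr i)).toLinearMap

/-- `ℋᵏ`: the complex-valued harmonic polynomial functions on `ℂ²ⁿ = ℝ⁴ⁿ` that are homogeneous of
(total) degree `k`. -/
def harmonic (n k : ℕ) : Submodule ℂ (CSpace n → ℂ) :=
  (MvPolynomial.homogeneousSubmodule (Idx n ⊕ Idx n) ℂ k ⊓ LinearMap.ker (laplace n)).map
    (toFunction n)

/-- The compact group `Sp(n) = U(2n) ∩ Sp(2n, ℂ)`, i.e. the unitary matrices of the form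
`(A, -conj B; B, conj A)`. -/
def compactSp (n : ℕ) : Submonoid (Matrix (Idx n) (Idx n) ℂ) :=
  Matrix.unitaryGroup (Idx n) ℂ ⊓ Matrix.symplecticGroup (Fin n) ℂ

/-- The left action of matrices on functions: `L(u) f (x) = f (u⁻¹ x)`. -/
def leftAction (n : ℕ) (u : Matrix (Idx n) (Idx n) ℂ) (f : CSpace n → ℂ) : CSpace n → ℂ :=
  fun x => f (u⁻¹ *ᵥ x)

/-- Right multiplication by the quaternion `q = a + j b`:
`(z + j w) q = (a z - b conj w) + j (a w + b conj z)`. -/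
def rightMul (n : ℕ) (a b : ℂ) (x : CSpace n) : CSpace n :=
  Sum.elim (fun r => a * x (Sum.inl r) - b * star (x (Sum.inr r)))
    (fun r => a * x (Sum.inr r) + b * star (x (Sum.inl r)))

/-- The right action of the quaternion `q = a + j b` on functions: `R(q) f (h) = f (h q)`. -/
def rightAction (n : ℕ) (a b : ℂ) (f : CSpace n → ℂ) : CSpace n → ℂ :=
  fun x => f (rightMul n a b x)

/-- The subgroup `1 × Sp(n-1)` of `Sp(n)`: the quaternionic matrices `diag(1, A)`. In complex form
these are the elements of `Sp(n)` whose rows and columns of index `z_1` and `w_1` are those of the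
identity matrix. -/
def subSp (n : ℕ) (hn : 2 ≤ n) : Set (Matrix (Idx n) (Idx n) ℂ) :=
  {u | u ∈ compactSp n ∧
    ∀ i j : Idx n,
      (i = Sum.inl ⟨0, by omega⟩ ∨ i = Sum.inr ⟨0, by omega⟩ ∨
        j = Sum.inl ⟨0, by omega⟩ ∨ j = Sum.inr ⟨0, by omega⟩) →
      u i j = (1 : Matrix (Idx n) (Idx n) ℂ) i j}

/-- The highest weight vector
`P_γ^{α,β} = w_1^(α-γ) (conj z_1)^(β-γ) (w_2 conj z_1 - w_1 conj z_2)^γ` (for `γ ≤ min α β`). -/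
def highestWeightVector (n : ℕ) (hn : 2 ≤ n) (α β γ : ℕ) : CSpace n → ℂ := fun x =>
  let z₁ := x (Sum.inl ⟨0, by omega⟩)
  let z₂ := x (Sum.inl ⟨1, by omega⟩)
  let w₁ := x (Sum.inr ⟨0, by omega⟩)
  let w₂ := x (Sum.inr ⟨1, by omega⟩)
  w₁ ^ (α - γ) * star z₁ ^ (β - γ) * (w₂ * star z₁ - w₁ * star z₂) ^ γ

/-- The component `V_γ^{α,β}`: the subspace invariant under the left action of `Sp(n)` that is
generated by the highest weight vector `P_γ^{α,β}`. -/
def component (n : ℕ) (hn : 2 ≤ n) (α β γ : ℕ) : Submodule ℂ (CSpace n → ℂ) :=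
  Submodule.span ℂ
    {f | ∃ u ∈ compactSp n, f = leftAction n u (highestWeightVector n hn α β γ)}

/-- The functions that are invariant under the left action of `1 × Sp(n-1)`. -/
def leftInvariants (n : ℕ) (hn : 2 ≤ n) : Submodule ℂ (CSpace n → ℂ) where
  carrier := {f | ∀ u ∈ subSp n hn, leftAction n u f = f}
  zero_mem' := fun _ _ => rfl
  add_mem' := fun {f g} hf hg u hu => by
    funext x
    exact congrArg₂ (· + ·) (congrFun (hf u hu) x) (congrFun (hg u hu) x)
  smul_mem' := fun c f hf u hu => by
    funext x
    exact congrArg (c • ·) (congrFun (hf u hu) x)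

/-- The functions that are invariant under the right action of `Sp(1)`, the group of unit
quaternions. -/
def rightInvariants (n : ℕ) : Submodule ℂ (CSpace n → ℂ) where
  carrier := {f | ∀ a b : ℂ, ‖a‖ ^ 2 + ‖b‖ ^ 2 = 1 → rightAction n a b f = f}
  zero_mem' := fun _ _ _ => rfl
  add_mem' := fun {f g} hf hg a b hab => by
    funext x
    exact congrArg₂ (· + ·) (congrFun (hf a b hab) x) (congrFun (hg a b hab) x)
  smul_mem' := fun c f hf a b hab => by
    funext x
    exact congrArg (c • ·) (congrFun (hf a b hab) x)

/-- `Inv_γ^{α,β}`: the elements of `V_γ^{α,β}` that are invariant under the left action of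
`1 × Sp(n-1)`. -/
def componentInvariants (n : ℕ) (hn : 2 ≤ n) (α β γ : ℕ) : Submodule ℂ (CSpace n → ℂ) :=
  component n hn α β γ ⊓ leftInvariants n hn

/-- The bi-invariant elements of `ℋᵏ`: those that are invariant under the left action of
`1 × Sp(n-1)` and under the right action of `Sp(1)`. -/
def biInvariants (n : ℕ) (hn : 2 ≤ n) (k : ℕ) : Submodule ℂ (CSpace n → ℂ) :=
  harmonic n k ⊓ leftInvariants n hn ⊓ rightInvariants n

end

end QuatHarm

/-!
Write `K = 1 × Sp(n-1)`, and let the line be the first coordinate line `ℍ × 0` of `ℍⁿ`, which `K`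
fixes pointwise. Everything is read off from restrictions to the line.

* Restriction is injective on `K`-invariant harmonic polynomials
  (`eq_zero_of_firstLine_eq_zero`). Since `Sp(n-1)` is transitive on spheres, such a polynomial is a
  polynomial in the first coordinate and in the squared norm `ρ` of the others, and the Laplace
  equation determines the coefficients of `ρ ^ m` successively from that of `ρ ^ 0`.
* Every element of a component has the same restriction as a `K`-invariant element of the component
  (`map_restrictLine_componentInvariants`): its part orthogonal to the kernel of the restriction,
  for a unitarily invariant inner product.

So the dimension of the invariants of a component is that of the restriction of the component to the
line. A translate of the highest weight vector restricts to a multiple of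
`(z s + w t) ^ (α - γ) * (conj z t - conj w s) ^ (β - γ) * |h| ^ (2 γ)`, for scalars `s` and `t`
that depend on the translation, and all ratios `s : t` with `s / t` a natural number occur. The
coefficients of these forms in `(s, t)` are linearly independent and number `α + β - 2 γ + 1`; they
span the restriction (`map_restrictLine_component`).

A bi-invariant harmonic polynomial restricts to a multiple of `|h| ^ k` on the line, so it is
determined by one value, and `k` is even since `-1` is a unit quaternion. For `k = 2 α` it exists,
because all of `V_α^{α,α}` is invariant on the right and this component has a nonzero `K`-invariant.
-/

namespace QuatHarm

open MvPolynomial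

/-! ### Polynomials in the coordinates and their conjugates -/

theorem toFunction_apply (n : ℕ) (p : ConjPoly n) (x : CSpace n) :
    toFunction n p x = aeval (Sum.elim x (star x) : Idx n ⊕ Idx n → ℂ) p := rfl

theorem toFunction_aeval (n : ℕ) {σ : Type*} (g : σ → ConjPoly n) (p : MvPolynomial σ ℂ)
    (x : CSpace n) :
    toFunction n (aeval g p) x = aeval (fun j => toFunction n (g j) x) p := by
  simp only [toFunction_apply]
  rw [← AlgHom.comp_apply, comp_aeval]

/-- A polynomial in `ζ` and `conj ζ` is determined by its values: in terms of the real and imaginary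
parts of `ζ` it becomes a polynomial that vanishes at all real points. -/
theorem toFunction_injective (n : ℕ) : Function.Injective (toFunction n) := by
  rw [← LinearMap.ker_eq_bot, LinearMap.ker_eq_bot']
  intro p hp
  -- `g` is `ζ = s + i t`, `conj ζ = s - i t`, and `g'` is the inverse substitution
  let g : Idx n ⊕ Idx n → ConjPoly n :=
    Sum.elim (fun i => X (Sum.inl i) + C Complex.I * X (Sum.inr i))
      (fun i => X (Sum.inl i) - C Complex.I * X (Sum.inr i))
  let g' : Idx n ⊕ Idx n → ConjPoly n :=
    Sum.elim (fun i => C (1 / 2) * (X (Sum.inl i) + X (Sum.inr i)))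
      (fun i => C (-Complex.I / 2) * (X (Sum.inl i) - X (Sum.inr i)))
  have hq : aeval g p = 0 := by
    refine funext_set (fun _ => Set.range ((↑) : ℝ → ℂ))
      (fun _ => Set.infinite_range_of_injective Complex.ofReal_injective) fun y hy => ?_
    have hstar : ∀ i, star (y i) = y i := fun i => by
      obtain ⟨t, ht⟩ := hy i (Set.mem_univ i)
      rw [← ht]; exact Complex.conj_ofReal t
    have := congrFun hp (fun i => y (Sum.inl i) + Complex.I * y (Sum.inr i))
    rw [toFunction_apply] at this
    rw [map_zero, ← coe_aeval_eq_eval, RingHom.coe_coe, ← AlgHom.comp_apply, comp_aeval]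
    rw [← Pi.zero_apply (M := fun _ => ℂ), ← this]
    congr 2
    funext j
    rcases j with i | i
    · simp [g]
    · have h1 := hstar (Sum.inl i)
      have h2 := hstar (Sum.inr i)
      simp only [RCLike.star_def] at h1 h2
      simp [g, h1, h2, sub_eq_add_neg]
  have hinv : aeval g' (aeval g p) = p := by
    rw [← AlgHom.comp_apply, comp_aeval]
    conv_rhs => rw [← AlgHom.id_apply (R := ℂ) p, ← aeval_X_left]
    congr 2
    funext j
    have hI : (C Complex.I * C (-Complex.I / 2) : ConjPoly n) = C (1 / 2) := by
      rw [← C_mul]; congr 1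
      linear_combination (-1 / 2) * Complex.I_sq
    have h2 : (C (1 / 2) + C (1 / 2) : ConjPoly n) = 1 := by
      rw [← C_add, ← C_1]; norm_num
    rcases j with i | i
    · simp only [g, g', Sum.elim_inl, Sum.elim_inr, map_add, map_mul, aeval_X, algHom_C,
        algebraMap_eq]
      linear_combination (X (Sum.inl i) - X (Sum.inr i)) * hI + X (Sum.inl i) * h2
    · simp only [g, g', Sum.elim_inl, Sum.elim_inr, map_sub, map_mul, aeval_X, algHom_C,
        algebraMap_eq]
      linear_combination -(X (Sum.inl i) - X (Sum.inr i)) * hI + X (Sum.inr i) * h2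
  rw [← hinv, hq, map_zero]

/-- The chain rule for a polynomial substitution. -/
theorem pderiv_aeval {σ τ : Type*} [Fintype σ] (g : σ → MvPolynomial τ ℂ) (i : τ)
    (p : MvPolynomial σ ℂ) :
    pderiv i (aeval g p) = ∑ j, aeval g (pderiv j p) * pderiv i (g j) := by
  classical
  induction p using MvPolynomial.induction_on with
  | C a => simp
  | add p q hp hq => simp only [map_add, hp, hq, add_mul, Finset.sum_add_distrib]
  | mul_X p k hp =>
    have h : ∀ j, aeval g (pderiv j (p * X k)) * pderiv i (g j) =
        aeval g (pderiv j p) * pderiv i (g j) * g k +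
          if j = k then aeval g p * pderiv i (g k) else 0 := by
      intro j
      rw [pderiv_mul, map_add, map_mul, map_mul, aeval_X, pderiv_X]
      by_cases hjk : j = k
      · subst hjk; rw [Pi.single_eq_same, map_one, if_pos rfl]; ring
      · rw [Pi.single_eq_of_ne (Ne.symm hjk), map_zero, if_neg hjk]; ring
    rw [Finset.sum_congr rfl fun j _ => h j, Finset.sum_add_distrib, Finset.sum_ite_eq' _ k,
      if_pos (Finset.mem_univ k), ← Finset.sum_mul, ← hp, map_mul, aeval_X, pderiv_mul]

theorem pderiv_aeval_of_pderiv_eq {σ : Type*} [Fintype σ] [DecidableEq σ]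
    (g : σ → MvPolynomial σ ℂ) (i : σ)
    (h : ∀ j, pderiv i (g j) = if j = i then 1 else 0) (p : MvPolynomial σ ℂ) :
    pderiv i (aeval g p) = aeval g (pderiv i p) := by
  rw [pderiv_aeval]
  simp [h]

theorem pderiv_comm {σ : Type*} (i j : σ) (p : MvPolynomial σ ℂ) :
    pderiv i (pderiv j p) = pderiv j (pderiv i p) := by
  classical
  have h : ⁅(pderiv i : Derivation ℂ (MvPolynomial σ ℂ) (MvPolynomial σ ℂ)), pderiv j⁆ =
      (0 : Derivation ℂ (MvPolynomial σ ℂ) (MvPolynomial σ ℂ)) := by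
    refine derivation_ext fun k => ?_
    simp only [Derivation.commutator_apply, pderiv_X, Pi.single_apply, Derivation.zero_apply]
    split_ifs <;> simp
  have := congrArg (fun D => D p) h
  simpa [Derivation.commutator_apply, sub_eq_zero] using this

/-- The substitution `x ↦ A x` on polynomials in the coordinates and their conjugates: the
conjugate variables are transformed by the entrywise conjugate of `A`. -/
noncomputable def linearSubst (n : ℕ) (A : Matrix (Idx n) (Idx n) ℂ) :
    Idx n ⊕ Idx n → ConjPoly n :=
  Sum.elim (fun i => ∑ j, C (A i j) * X (Sum.inl j))
    (fun i => ∑ j, C (star (A i j)) * X (Sum.inr j))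

theorem toFunction_linearSubst (n : ℕ) (A : Matrix (Idx n) (Idx n) ℂ) (p : ConjPoly n)
    (x : CSpace n) :
    toFunction n (aeval (linearSubst n A) p) x = toFunction n p (A *ᵥ x) := by
  rw [toFunction_aeval, toFunction_apply n p]
  congr 2
  funext j
  rcases j with i | i
  · simp [linearSubst, toFunction_apply, Matrix.mulVec, dotProduct]
  · simp [linearSubst, toFunction_apply, Matrix.mulVec, dotProduct]

theorem laplace_apply (n : ℕ) (p : ConjPoly n) :
    laplace n p = (4 : ℂ) • ∑ i : Idx n, pderiv (Sum.inl i) (pderiv (Sum.inr i) p) := by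
  simp [laplace]

theorem laplace_linearSubst (n : ℕ) {A : Matrix (Idx n) (Idx n) ℂ}
    (hA : A * star A = 1) (p : ConjPoly n) :
    laplace n (aeval (linearSubst n A) p) = aeval (linearSubst n A) (laplace n p) := by
  have hl : ∀ (i : Idx n) (q : ConjPoly n), pderiv (Sum.inl i) (aeval (linearSubst n A) q) =
      ∑ j, aeval (linearSubst n A) (pderiv (Sum.inl j) q) * C (A j i) := by
    intro i q
    classical
    rw [pderiv_aeval, Fintype.sum_sum_type]
    simp [linearSubst, pderiv_X, Pi.single_apply, -Fintype.sum_sum_type]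
  have hr : ∀ (i : Idx n) (q : ConjPoly n), pderiv (Sum.inr i) (aeval (linearSubst n A) q) =
      ∑ j, aeval (linearSubst n A) (pderiv (Sum.inr j) q) * C (star (A j i)) := by
    intro i q
    classical
    rw [pderiv_aeval, Fintype.sum_sum_type]
    simp [linearSubst, pderiv_X, Pi.single_apply, -Fintype.sum_sum_type]
  have hAA : ∀ j k : Idx n, ∑ i, A j i * star (A k i) = if j = k then 1 else 0 := by
    intro j k
    have := congrFun (congrFun hA j) k
    simpa [Matrix.mul_apply, Matrix.one_apply, Matrix.star_apply] using this
  rw [laplace_apply, laplace_apply, map_smul, map_sum]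
  congr 1
  calc ∑ i, pderiv (Sum.inl i) (pderiv (Sum.inr i) (aeval (linearSubst n A) p))
      = ∑ i, ∑ k, ∑ j, aeval (linearSubst n A) (pderiv (Sum.inl j) (pderiv (Sum.inr k) p)) *
          C (A j i * star (A k i)) := by
        refine Finset.sum_congr rfl fun i _ => ?_
        rw [hr, map_sum]
        refine Finset.sum_congr rfl fun k _ => ?_
        rw [pderiv_mul, hl, pderiv_C, mul_zero, add_zero, Finset.sum_mul]
        exact Finset.sum_congr rfl fun j _ => by rw [C_mul]; ring
    _ = ∑ k, ∑ j, aeval (linearSubst n A) (pderiv (Sum.inl j) (pderiv (Sum.inr k) p)) *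
          C (∑ i, A j i * star (A k i)) := by
        rw [Finset.sum_comm]
        refine Finset.sum_congr rfl fun k _ => ?_
        rw [Finset.sum_comm]
        exact Finset.sum_congr rfl fun j _ => by rw [map_sum, Finset.mul_sum]
    _ = _ := by
        refine Finset.sum_congr rfl fun k _ => ?_
        simp only [hAA, apply_ite C, C_1, C_0, mul_ite, mul_one, mul_zero, Finset.sum_ite_eq',
          Finset.mem_univ, if_true]

theorem isHomogeneous_linearSubst (n : ℕ) (A : Matrix (Idx n) (Idx n) ℂ) {p : ConjPoly n} {k : ℕ}
    (hp : p.IsHomogeneous k) : (aeval (linearSubst n A) p).IsHomogeneous k := by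
  have h : ∀ j, (linearSubst n A j).IsHomogeneous 1 := by
    rintro (i | i)
    · exact IsHomogeneous.sum Finset.univ (fun j => C (A i j) * X (Sum.inl j)) 1
        fun j _ => isHomogeneous_C_mul_X _ _
    · exact IsHomogeneous.sum Finset.univ (fun j => C (star (A i j)) * X (Sum.inr j)) 1
        fun j _ => isHomogeneous_C_mul_X _ _
  have := hp.aeval (linearSubst n A) h
  rwa [one_mul] at this

/-- Unitary changes of coordinates preserve harmonic polynomials. -/
theorem comp_mulVec_mem_harmonic {n k : ℕ} {A : Matrix (Idx n) (Idx n) ℂ}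
    (hA : A * star A = 1) {f : CSpace n → ℂ} (hf : f ∈ harmonic n k) :
    (fun x => f (A *ᵥ x)) ∈ harmonic n k := by
  obtain ⟨p, ⟨hp, hp'⟩, rfl⟩ := hf
  refine ⟨aeval (linearSubst n A) p, ⟨isHomogeneous_linearSubst n A hp, ?_⟩, ?_⟩
  · rw [SetLike.mem_coe, LinearMap.mem_ker] at hp' ⊢
    rw [laplace_linearSubst n hA, hp', map_zero]
  · funext x
    exact toFunction_linearSubst n A p x

theorem harmonic_smul {n k : ℕ} {f : CSpace n → ℂ} (hf : f ∈ harmonic n k) (t : ℝ)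
    (x : CSpace n) : f (t • x) = (t : ℂ) ^ k * f x := by
  obtain ⟨p, ⟨hp, -⟩, rfl⟩ := hf
  have hp : p.IsHomogeneous k := hp
  have hx : (Sum.elim (t • x) (star (t • x)) : Idx n ⊕ Idx n → ℂ) =
      fun j => (t : ℂ) * (Sum.elim x (star x) : Idx n ⊕ Idx n → ℂ) j := by
    funext j
    rcases j with i | i <;> simp
  rw [toFunction_apply, toFunction_apply, hx, aeval_def, aeval_def, eval₂_eq, eval₂_eq,
    Finset.mul_sum]
  refine Finset.sum_congr rfl fun d hd => ?_
  have hd' : ∑ i ∈ d.support, d i = k := by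
    rw [← hp (mem_support_iff.1 hd), Finsupp.weight_apply, Finsupp.sum]
    simp
  rw [← hd', ← Finset.prod_pow_eq_pow_sum]
  simp only [mul_pow, Finset.prod_mul_distrib]
  ring

theorem continuous_of_mem_harmonic {n k : ℕ} {f : CSpace n → ℂ} (hf : f ∈ harmonic n k) :
    Continuous f := by
  obtain ⟨p, -, rfl⟩ := hf
  have : (toFunction n p) = fun x => eval (Sum.elim x (star x) : Idx n ⊕ Idx n → ℂ) p := by
    funext x; rw [toFunction_apply]; rfl
  rw [this]
  refine (MvPolynomial.continuous_eval p).comp (continuous_pi ?_)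
  rintro (i | i)
  · exact continuous_apply i
  · exact (continuous_apply i).star

instance (n k : ℕ) : FiniteDimensional ℂ (harmonic n k) := by
  have h1 : FiniteDimensional ℂ (homogeneousSubmodule (Idx n ⊕ Idx n) ℂ k) :=
    Module.Finite.iff_fg.2 (homogeneousSubmodule_fg _ _ k)
  have h2 : FiniteDimensional ℂ
      (homogeneousSubmodule (Idx n ⊕ Idx n) ℂ k ⊓ LinearMap.ker (laplace n) : Submodule ℂ _) :=
    Submodule.finiteDimensional_of_le inf_le_left
  exact Module.Finite.iff_fg.2 ((Module.Finite.iff_fg.1 h2).map _)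

/-! ### Transitivity of `Sp(n)` on spheres -/

/-- A block reflection. If `V` and `W` have the same Gram matrix, `X = V - W` and `E` is the inverse
of `Xᴴ V`, then `1 - X E Xᴴ` is unitary and carries `V` to `W`. Unitarity comes from the identity
`Xᴴ X = Xᴴ V + (Xᴴ V)ᴴ`. -/
theorem householder_unitary {m k : Type*} [Fintype m] [DecidableEq m] [Fintype k] [DecidableEq k]
    {V W : Matrix m k ℂ} {E : Matrix k k ℂ} (hVW : Vᴴ * V = Wᴴ * W)
    (hE : (V - W)ᴴ * V * E = 1) (hE' : E * ((V - W)ᴴ * V) = 1) :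
    (1 - (V - W) * E * (V - W)ᴴ) ∈ Matrix.unitaryGroup m ℂ ∧
      (1 - (V - W) * E * (V - W)ᴴ) * V = W := by
  set X := V - W with hX
  constructor
  · rw [Matrix.mem_unitaryGroup_iff', Matrix.star_eq_conjTranspose]
    have hD : Xᴴ * X = Xᴴ * V + (Xᴴ * V)ᴴ := by
      rw [Matrix.conjTranspose_mul, Matrix.conjTranspose_conjTranspose]
      rw [hX]
      simp only [Matrix.conjTranspose_sub, Matrix.sub_mul, Matrix.mul_sub]
      rw [hVW]; abel
    have hD' : Eᴴ * (Xᴴ * X) * E = Eᴴ + E := by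
      rw [hD, Matrix.mul_add, Matrix.add_mul, Matrix.mul_assoc, hE, Matrix.mul_one,
        ← Matrix.conjTranspose_mul, hE, Matrix.conjTranspose_one, Matrix.one_mul]
    have : X * Eᴴ * Xᴴ * (X * E * Xᴴ) = X * Eᴴ * Xᴴ + X * E * Xᴴ := by
      rw [← Matrix.add_mul, ← Matrix.mul_add, ← hD']
      simp only [Matrix.mul_assoc]
    simp only [Matrix.conjTranspose_sub, Matrix.conjTranspose_one, Matrix.conjTranspose_mul,
      Matrix.conjTranspose_conjTranspose, Matrix.sub_mul, Matrix.mul_sub, Matrix.one_mul,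
      Matrix.mul_one]
    rw [← Matrix.mul_assoc X, this]; abel
  · rw [Matrix.sub_mul, Matrix.one_mul, Matrix.mul_assoc, Matrix.mul_assoc, hE', Matrix.mul_one, hX]
    abel

/-- The complex matrices that come from quaternionic ones, acting on the left: those that commute
with the conjugate-linear map `x ↦ J (conj x)`, which is right multiplication by `j`. -/
def IsQuaternionic {m n : ℕ} (M : Matrix (Idx m) (Idx n) ℂ) : Prop :=
  M * Matrix.J (Fin n) ℂ = Matrix.J (Fin m) ℂ * M.map (starRingEnd ℂ)

namespace IsQuaternionic

theorem sub {m n : ℕ} {M N : Matrix (Idx m) (Idx n) ℂ} (hM : IsQuaternionic M)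
    (hN : IsQuaternionic N) : IsQuaternionic (M - N) := by
  rw [IsQuaternionic, Matrix.sub_mul, hM, hN, ← Matrix.mul_sub]
  congr 1
  ext i j; simp

theorem one (n : ℕ) : IsQuaternionic (1 : Matrix (Idx n) (Idx n) ℂ) := by
  rw [IsQuaternionic, Matrix.map_one _ (map_zero _) (map_one _), Matrix.one_mul, Matrix.mul_one]

theorem mul {m n k : ℕ} {M : Matrix (Idx m) (Idx n) ℂ} {N : Matrix (Idx n) (Idx k) ℂ}
    (hM : IsQuaternionic M) (hN : IsQuaternionic N) : IsQuaternionic (M * N) := by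
  rw [IsQuaternionic, Matrix.mul_assoc, hN, ← Matrix.mul_assoc, hM, Matrix.mul_assoc,
    Matrix.map_mul]

theorem conjTranspose {m n : ℕ} {M : Matrix (Idx m) (Idx n) ℂ} (hM : IsQuaternionic M) :
    IsQuaternionic Mᴴ := by
  have h := congrArg Matrix.conjTranspose hM
  have hJ : ∀ l : ℕ, (Matrix.J (Fin l) ℂ)ᴴ = - Matrix.J (Fin l) ℂ := fun l => by
    simp [Matrix.J, Matrix.fromBlocks_conjTranspose, Matrix.fromBlocks_neg]
  have h2 : (M.map (starRingEnd ℂ))ᴴ = Mᴴ.map (starRingEnd ℂ) := by ext i j; simp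
  rw [Matrix.conjTranspose_mul, Matrix.conjTranspose_mul, hJ, hJ, h2, Matrix.neg_mul,
    Matrix.mul_neg, neg_inj] at h
  have key : Mᴴ.map (starRingEnd ℂ) = - (Matrix.J (Fin n) ℂ * Mᴴ * Matrix.J (Fin m) ℂ) := by
    rw [h, Matrix.mul_assoc, Matrix.J_squared]; simp
  rw [IsQuaternionic, key, Matrix.mul_neg, ← Matrix.mul_assoc, ← Matrix.mul_assoc,
    Matrix.J_squared]
  simp

theorem of_mul_eq_one {m : ℕ} {M N : Matrix (Idx m) (Idx m) ℂ} (hM : IsQuaternionic M)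
    (h : M * N = 1) : IsQuaternionic N := by
  have h' : N * M = 1 := mul_eq_one_comm.1 h
  have h2 : M.map (starRingEnd ℂ) * N.map (starRingEnd ℂ) = 1 := by
    rw [← Matrix.map_mul, h, Matrix.map_one _ (map_zero _) (map_one _)]
  rw [IsQuaternionic]
  calc N * Matrix.J (Fin m) ℂ
      = N * (Matrix.J (Fin m) ℂ * M.map (starRingEnd ℂ)) * N.map (starRingEnd ℂ) := by
        rw [Matrix.mul_assoc, Matrix.mul_assoc, h2, Matrix.mul_one]
    _ = _ := by rw [← hM, ← Matrix.mul_assoc, h', Matrix.one_mul]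

end IsQuaternionic

/-- Among unitary matrices, the symplectic ones are the quaternionic ones. -/
theorem mem_compactSp_iff {n : ℕ} {u : Matrix (Idx n) (Idx n) ℂ} :
    u ∈ compactSp n ↔ u ∈ Matrix.unitaryGroup (Idx n) ℂ ∧ IsQuaternionic u := by
  rw [compactSp, Submonoid.mem_inf]
  refine and_congr_right fun hu => ?_
  have h1 : u.map (starRingEnd ℂ) * uᵀ = 1 := by
    have h := congrArg (fun M => Matrix.map M (starRingEnd ℂ)) (Matrix.mem_unitaryGroup_iff.1 hu)
    simp only [Matrix.map_mul,
      Matrix.map_one _ (map_zero (starRingEnd ℂ)) (map_one (starRingEnd ℂ))] at h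
    rw [← h]; congr 1
    ext i j; simp [Matrix.star_apply]
  have h2 : uᵀ * u.map (starRingEnd ℂ) = 1 := mul_eq_one_comm.1 h1
  rw [SymplecticGroup.mem_iff, IsQuaternionic]
  constructor
  · intro h
    nth_rw 2 [← h]
    rw [Matrix.mul_assoc (u * _), h2, Matrix.mul_one]
  · intro h
    rw [h, Matrix.mul_assoc, h1, Matrix.mul_one]

theorem star_mem_compactSp {n : ℕ} {u : Matrix (Idx n) (Idx n) ℂ} (hu : u ∈ compactSp n) :
    star u ∈ compactSp n := by
  rw [mem_compactSp_iff] at hu ⊢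
  exact ⟨Unitary.star_mem hu.1, hu.2.conjTranspose⟩

theorem inv_eq_star {n : ℕ} {u : Matrix (Idx n) (Idx n) ℂ} (hu : u ∈ compactSp n) :
    u⁻¹ = star u :=
  Matrix.inv_eq_right_inv (Matrix.mem_unitaryGroup_iff.1 hu.1)

theorem inv_mem_compactSp {n : ℕ} {u : Matrix (Idx n) (Idx n) ℂ} (hu : u ∈ compactSp n) :
    u⁻¹ ∈ compactSp n := by
  rw [inv_eq_star hu]; exact star_mem_compactSp hu

theorem rightMul_eq (n : ℕ) (a b : ℂ) (x : CSpace n) :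
    rightMul n a b x = a • x + b • (Matrix.J (Fin n) ℂ *ᵥ star x) := by
  funext i
  rcases i with i | i
  · simp [rightMul, Matrix.J, Matrix.fromBlocks_mulVec, Matrix.neg_mulVec, sub_eq_add_neg]
  · simp [rightMul, Matrix.J, Matrix.fromBlocks_mulVec]

theorem mulVec_rightMul {n : ℕ} {u : Matrix (Idx n) (Idx n) ℂ} (hu : u ∈ compactSp n) (a b : ℂ)
    (x : CSpace n) : u *ᵥ rightMul n a b x = rightMul n a b (u *ᵥ x) := by
  have h : u.map (starRingEnd ℂ) *ᵥ star x = star (u *ᵥ x) := by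
    funext i; simp [Matrix.mulVec, dotProduct]
  rw [rightMul_eq, rightMul_eq, Matrix.mulVec_add, Matrix.mulVec_smul, Matrix.mulVec_smul,
    Matrix.mulVec_mulVec, (mem_compactSp_iff.1 hu).2, ← Matrix.mulVec_mulVec, h]

/-- The `2n × 2` complex matrix of a quaternionic column `x`, with columns `x` and `x j`. -/
def quatColumn {n : ℕ} (x : CSpace n) : Matrix (Idx n) (Idx 1) ℂ :=
  Matrix.of fun i j => Sum.elim (fun _ => x i) (fun _ => (Matrix.J (Fin n) ℂ *ᵥ star x) i) j

theorem J_mulVec_inl {n : ℕ} (x : CSpace n) (r : Fin n) :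
    (Matrix.J (Fin n) ℂ *ᵥ x) (Sum.inl r) = - x (Sum.inr r) := by
  simp [Matrix.J, Matrix.fromBlocks_mulVec, Matrix.neg_mulVec]

theorem J_mulVec_inr {n : ℕ} (x : CSpace n) (r : Fin n) :
    (Matrix.J (Fin n) ℂ *ᵥ x) (Sum.inr r) = x (Sum.inl r) := by
  simp [Matrix.J, Matrix.fromBlocks_mulVec]

theorem isQuaternionic_quatColumn {n : ℕ} (x : CSpace n) : IsQuaternionic (quatColumn x) := by
  rw [IsQuaternionic]
  ext i j
  rcases i with i | i <;> rcases j with j | j <;>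
    simp [quatColumn, Matrix.mul_apply, Matrix.J, Matrix.fromBlocks_mulVec, Matrix.neg_mulVec,
      Matrix.one_apply, Subsingleton.elim j 0]

/-- The two columns are orthogonal and have the same norm, that of the quaternionic column. -/
theorem quatColumn_gram {n : ℕ} (x : CSpace n) :
    (quatColumn x)ᴴ * quatColumn x =
      ((∑ i, ‖x i‖ ^ 2 : ℝ) : ℂ) • (1 : Matrix (Idx 1) (Idx 1) ℂ) := by
  ext i j
  rcases i with i | i <;> rcases j with j | j <;>
    simp [quatColumn, Matrix.mul_apply, Fintype.sum_sum_type, Subsingleton.elim i j,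
      J_mulVec_inl, J_mulVec_inr, Complex.mul_conj', mul_comm, add_comm]

theorem quatColumn_sub {n : ℕ} (x y : CSpace n) :
    quatColumn x - quatColumn y = quatColumn (x - y) := by
  ext i j
  rcases j with j | j <;> simp [quatColumn, Matrix.mulVec_sub]

open scoped ComplexOrder in
/-- A matrix `D` whose Hermitian part is a nonzero scalar is invertible: on the kernel of `D` the
form `star v ⬝ᵥ (D + Dᴴ) *ᵥ v = c * (star v ⬝ᵥ v)` vanishes. -/
theorem isUnit_det_of_add_conjTranspose {m : Type*} [Fintype m] [DecidableEq m]
    {D : Matrix m m ℂ} {c : ℂ} (hc : c ≠ 0) (hD : D + Dᴴ = c • (1 : Matrix m m ℂ)) :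
    IsUnit D.det := by
  rw [isUnit_iff_ne_zero]
  intro h0
  obtain ⟨v, hv, hDv⟩ := Matrix.exists_mulVec_eq_zero_iff.2 h0
  have h := congrArg (fun M => star v ⬝ᵥ (M *ᵥ v)) hD
  have h1 : star v ⬝ᵥ (Dᴴ *ᵥ v) = 0 := by
    rw [Matrix.dotProduct_mulVec, ← Matrix.star_mulVec, hDv]; simp
  simp only [Matrix.add_mulVec, hDv, zero_add, h1, Matrix.smul_mulVec, Matrix.one_mulVec,
    dotProduct_smul, smul_eq_mul] at h
  rcases mul_eq_zero.1 h.symm with h | h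
  · exact hc h
  · exact hv (dotProduct_star_self_eq_zero.1 h)

/-- `Sp(n)` is transitive on spheres. The element that carries `x` to `y` can be chosen to be the
block reflection attached to the quaternionic columns `x` and `y`, and this fixes every quaternionic
coordinate that `x` and `y` have in common. -/
theorem exists_compactSp_mulVec_eq {n : ℕ} {x y : CSpace n}
    (h : ∑ i, ‖x i‖ ^ 2 = ∑ i, ‖y i‖ ^ 2) :
    ∃ u ∈ compactSp n, u *ᵥ x = y ∧
      ∀ r : Fin n, x (Sum.inl r) = y (Sum.inl r) → x (Sum.inr r) = y (Sum.inr r) →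
        ∀ i j : Idx n, (i = Sum.inl r ∨ i = Sum.inr r ∨ j = Sum.inl r ∨ j = Sum.inr r) →
          u i j = (1 : Matrix (Idx n) (Idx n) ℂ) i j := by
  by_cases hxy : x = y
  · exact ⟨1, one_mem _, by rw [Matrix.one_mulVec, hxy], fun _ _ _ _ _ _ => rfl⟩
  set D := (quatColumn x - quatColumn y)ᴴ * quatColumn x with hDdef
  have hgram : (quatColumn x)ᴴ * quatColumn x = (quatColumn y)ᴴ * quatColumn y := by
    rw [quatColumn_gram, quatColumn_gram, h]
  have hc : ((∑ i, ‖(x - y) i‖ ^ 2 : ℝ) : ℂ) ≠ 0 := by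
    rw [Complex.ofReal_ne_zero]
    intro h0
    rw [Finset.sum_eq_zero_iff_of_nonneg fun i _ => by positivity] at h0
    refine hxy (funext fun i => sub_eq_zero.1 ?_)
    simpa using h0 i (Finset.mem_univ i)
  have hD : D + Dᴴ = ((∑ i, ‖(x - y) i‖ ^ 2 : ℝ) : ℂ) • (1 : Matrix (Idx 1) (Idx 1) ℂ) := by
    rw [← quatColumn_gram, ← quatColumn_sub, hDdef, Matrix.conjTranspose_mul,
      Matrix.conjTranspose_conjTranspose]
    simp only [Matrix.conjTranspose_sub, Matrix.sub_mul, Matrix.mul_sub]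
    rw [hgram]; abel
  have hu := isUnit_det_of_add_conjTranspose hc hD
  have hE : D * D⁻¹ = 1 := Matrix.mul_nonsing_inv D hu
  have hE' : D⁻¹ * D = 1 := Matrix.nonsing_inv_mul D hu
  have hX : IsQuaternionic (quatColumn x - quatColumn y) :=
    (isQuaternionic_quatColumn x).sub (isQuaternionic_quatColumn y)
  obtain ⟨hunit, hmul⟩ := householder_unitary hgram hE hE'
  refine ⟨_, mem_compactSp_iff.2 ⟨hunit, (IsQuaternionic.one n).sub ((hX.mul ?_).mul
    hX.conjTranspose)⟩, ?_, ?_⟩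
  · exact (hX.conjTranspose.mul (isQuaternionic_quatColumn x)).of_mul_eq_one hE
  · funext i
    have := congrFun (congrFun hmul i) (Sum.inl 0)
    simpa [quatColumn, Matrix.mul_apply, Matrix.mulVec, dotProduct] using this
  · intro r h1 h2 i j hij
    have hrow : ∀ i : Idx n, (i = Sum.inl r ∨ i = Sum.inr r) → ∀ k,
        (quatColumn x - quatColumn y) i k = 0 := by
      rw [quatColumn_sub]
      rintro i (rfl | rfl) (k | k) <;>
        simp [quatColumn, J_mulVec_inl, J_mulVec_inr, h1, h2]
    rw [Matrix.sub_apply, sub_eq_self]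
    have hij' : (i = Sum.inl r ∨ i = Sum.inr r) ∨ (j = Sum.inl r ∨ j = Sum.inr r) := by tauto
    rcases hij' with hi | hj
    · rw [Matrix.mul_assoc, Matrix.mul_apply]
      exact Finset.sum_eq_zero fun k _ => by rw [hrow i hi k, zero_mul]
    · rw [Matrix.mul_apply]
      exact Finset.sum_eq_zero fun k _ => by
        rw [Matrix.conjTranspose_apply, hrow j hj k, star_zero, mul_zero]

/-- `1 × Sp(n-1)` is transitive on the points with given norm and given first coordinate. -/
theorem leftInvariants_apply_eq {n : ℕ} {hn : 2 ≤ n} {f : CSpace n → ℂ}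
    (hf : f ∈ leftInvariants n hn) {x y : CSpace n} (h : ∑ i, ‖x i‖ ^ 2 = ∑ i, ‖y i‖ ^ 2)
    (hz : x (Sum.inl ⟨0, by omega⟩) = y (Sum.inl ⟨0, by omega⟩))
    (hw : x (Sum.inr ⟨0, by omega⟩) = y (Sum.inr ⟨0, by omega⟩)) : f x = f y := by
  obtain ⟨u, hu, hux, hfix⟩ := exists_compactSp_mulVec_eq h
  have h1 := congrFun (hf u ⟨hu, fun i j hij => hfix _ hz hw i j hij⟩) y
  have h2 : u⁻¹ * u = 1 := by
    rw [inv_eq_star hu]; exact Matrix.mem_unitaryGroup_iff'.1 hu.1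
  rw [leftAction, ← hux, Matrix.mulVec_mulVec, h2, Matrix.one_mulVec] at h1
  rw [h1, hux]

/-- The point `(a + j b, 0, …, 0)` of the first coordinate line of `ℍⁿ`, written as a right multiple
of the first basis vector. -/
noncomputable def firstLine (n : ℕ) (hn : 2 ≤ n) (a b : ℂ) : CSpace n :=
  rightMul n a b (Pi.single (Sum.inl ⟨0, by omega⟩) 1)

theorem firstLine_eq (n : ℕ) (hn : 2 ≤ n) (a b : ℂ) :
    firstLine n hn a b =
      Pi.single (Sum.inl ⟨0, by omega⟩) a + Pi.single (Sum.inr ⟨0, by omega⟩) b := by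
  funext i
  rcases i with i | i <;> simp [firstLine, rightMul, Pi.single_apply]

/-! ### Harmonic polynomials invariant under `1 × Sp(n-1)` -/

/-- The partial Laplace operator `∑ ∂² / ∂ζ_i ∂(conj ζ_i)`, over the `i` in `S`, without the
factor `4` of `laplace`. -/
noncomputable def partialLaplace {n : ℕ} (S : Finset (Idx n)) : ConjPoly n →ₗ[ℂ] ConjPoly n :=
  ∑ i ∈ S, (pderiv (Sum.inl i)).toLinearMap ∘ₗ (pderiv (Sum.inr i)).toLinearMap

theorem partialLaplace_apply {n : ℕ} (S : Finset (Idx n)) (p : ConjPoly n) :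
    partialLaplace S p = ∑ i ∈ S, pderiv (Sum.inl i) (pderiv (Sum.inr i) p) := by
  simp [partialLaplace]

theorem partialLaplace_comm {n : ℕ} (S T : Finset (Idx n)) (p : ConjPoly n) :
    partialLaplace S (partialLaplace T p) = partialLaplace T (partialLaplace S p) := by
  simp only [partialLaplace_apply, map_sum]
  rw [Finset.sum_comm]
  refine Finset.sum_congr rfl fun i _ => Finset.sum_congr rfl fun j _ => ?_
  rw [pderiv_comm (Sum.inr i) (Sum.inl j), pderiv_comm (Sum.inl i) (Sum.inl j),
    pderiv_comm (Sum.inr i) (Sum.inr j), pderiv_comm (Sum.inl i) (Sum.inr j)]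

theorem partialLaplace_aeval {n : ℕ} {S : Finset (Idx n)} (g : Idx n ⊕ Idx n → ConjPoly n)
    (hl : ∀ i ∈ S, ∀ j, pderiv (Sum.inl i) (g j) = if j = Sum.inl i then 1 else 0)
    (hr : ∀ i ∈ S, ∀ j, pderiv (Sum.inr i) (g j) = if j = Sum.inr i then 1 else 0)
    (p : ConjPoly n) :
    partialLaplace S (aeval g p) = aeval g (partialLaplace S p) := by
  simp only [partialLaplace_apply, map_sum]
  refine Finset.sum_congr rfl fun i hi => ?_
  rw [pderiv_aeval_of_pderiv_eq g _ (hr i hi), pderiv_aeval_of_pderiv_eq g _ (hl i hi)]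

theorem pow_partialLaplace_aeval {n : ℕ} {S : Finset (Idx n)} (g : Idx n ⊕ Idx n → ConjPoly n)
    (hl : ∀ i ∈ S, ∀ j, pderiv (Sum.inl i) (g j) = if j = Sum.inl i then 1 else 0)
    (hr : ∀ i ∈ S, ∀ j, pderiv (Sum.inr i) (g j) = if j = Sum.inr i then 1 else 0)
    (m : ℕ) (p : ConjPoly n) :
    (partialLaplace S ^ m) (aeval g p) = aeval g ((partialLaplace S ^ m) p) := by
  induction m generalizing p with
  | zero => rfl
  | succ m ih => rw [pow_succ, Module.End.mul_apply, Module.End.mul_apply,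
      partialLaplace_aeval g hl hr, ih]

/-- On harmonic polynomials the Laplace operators in two complementary sets of coordinates are
opposite, and so are their powers up to sign since they commute. -/
theorem pow_partialLaplace_compl {n : ℕ} (S : Finset (Idx n)) {p : ConjPoly n}
    (hp : laplace n p = 0) (m : ℕ) :
    (partialLaplace Sᶜ ^ m) p = (-1 : ℂ) ^ m • (partialLaplace S ^ m) p := by
  have h0 : partialLaplace Sᶜ p = - partialLaplace S p := by
    rw [laplace_apply, smul_eq_zero, or_iff_right (by norm_num),
      ← Finset.sum_compl_add_sum S] at hp
    rw [partialLaplace_apply, partialLaplace_apply]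
    exact eq_neg_of_add_eq_zero_left hp
  have hcomm : Commute (partialLaplace Sᶜ) (partialLaplace S) :=
    LinearMap.ext fun q => partialLaplace_comm Sᶜ S q
  induction m with
  | zero => simp
  | succ m ih =>
    rw [pow_succ', Module.End.mul_apply, ih, map_smul, ← Module.End.mul_apply,
      (hcomm.pow_right m).eq, Module.End.mul_apply, h0, map_neg, pow_succ (partialLaplace S),
      Module.End.mul_apply, pow_succ, mul_neg_one, neg_smul, smul_neg]

/-- The squared norm `∑ ζ_i conj ζ_i` over the `i` in `S`, as a polynomial. -/
noncomputable def normSqPoly {n : ℕ} (S : Finset (Idx n)) : ConjPoly n :=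
  ∑ i ∈ S, X (Sum.inl i) * X (Sum.inr i)

theorem partialLaplace_normSqPoly_pow {n : ℕ} (S : Finset (Idx n)) (m : ℕ) :
    partialLaplace S (normSqPoly S ^ (m + 1)) =
      (((m + 1) * (m + S.card) : ℕ) : ℂ) • normSqPoly S ^ m := by
  have hr : ∀ i ∈ S, pderiv (Sum.inr i) (normSqPoly S) = X (Sum.inl i) := by
    intro i hi
    simp [normSqPoly, pderiv_X, Pi.single_apply, hi]
  have hl : ∀ i ∈ S, pderiv (Sum.inl i) (normSqPoly S) = X (Sum.inr i) := by
    intro i hi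
    simp [normSqPoly, pderiv_X, Pi.single_apply, hi]
  have h : ∀ i ∈ S, pderiv (Sum.inl i) (pderiv (Sum.inr i) (normSqPoly S ^ (m + 1))) =
      (((m + 1) * m : ℕ) : ConjPoly n) *
          (normSqPoly S ^ (m - 1) * (X (Sum.inl i) * X (Sum.inr i))) +
        ((m + 1 : ℕ) : ConjPoly n) * normSqPoly S ^ m := by
    intro i hi
    rw [pderiv_pow, hr i hi, pderiv_mul, pderiv_mul, pderiv_pow, hl i hi, pderiv_X_self,
      Nat.add_sub_cancel, ← map_natCast (C : ℂ →+* ConjPoly n) (m + 1), pderiv_C]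
    rw [map_natCast]
    push_cast; ring
  rw [partialLaplace_apply, Finset.sum_congr rfl h, Finset.sum_add_distrib, ← Finset.mul_sum,
    ← Finset.mul_sum, Finset.sum_const, ← normSqPoly, smul_eq_C_mul, map_natCast]
  rcases m with _ | m
  · simp
  · rw [Nat.add_sub_cancel, ← pow_succ]
    push_cast; rw [nsmul_eq_mul]; ring

/-- At a point where `ρ = normSqPoly S` vanishes, the `m`-th power of the Laplace operator in the
coordinates of `S` reads off the coefficient of `ρ ^ m` in a polynomial `G(ρ)`. -/
theorem exists_eval_pow_partialLaplace {n : ℕ} {S : Finset (Idx n)} (hS : S.Nonempty) (m : ℕ)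
    {y : Idx n ⊕ Idx n → ℂ} (hy : ∀ i ∈ S, y (Sum.inl i) = 0) :
    ∃ c : ℂ, c ≠ 0 ∧ ∀ G : Polynomial ℂ,
      eval y ((partialLaplace S ^ m) (Polynomial.aeval (normSqPoly S) G)) = c * G.coeff m := by
  have hρ : eval y (normSqPoly S) = 0 := by
    rw [normSqPoly, map_sum]
    exact Finset.sum_eq_zero fun i hi => by rw [map_mul, eval_X, hy i hi, zero_mul]
  obtain ⟨c, hc, h⟩ : ∃ c : ℂ, c ≠ 0 ∧ ∀ i : ℕ,
      eval y ((partialLaplace S ^ m) (normSqPoly S ^ i)) = if i = m then c else 0 := by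
    induction m with
    | zero =>
      refine ⟨1, one_ne_zero, fun i => ?_⟩
      rw [pow_zero, Module.End.one_apply, map_pow, hρ, zero_pow_eq]
    | succ m ih =>
      obtain ⟨c, hc, h⟩ := ih
      refine ⟨((m + 1) * (m + S.card) : ℕ) * c, mul_ne_zero ?_ hc, fun i => ?_⟩
      · have := hS.card_pos
        exact Nat.cast_ne_zero.2 (by positivity)
      · rw [pow_succ, Module.End.mul_apply]
        rcases i with _ | i
        · have : partialLaplace S (normSqPoly S ^ 0) = 0 := by
            simp [partialLaplace_apply]
          rw [this]; simp
        · rw [partialLaplace_normSqPoly_pow, map_smul, smul_eval, h i]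
          by_cases hi : i = m
          · simp [hi]
          · simp [hi]
  refine ⟨c, hc, fun G => ?_⟩
  induction G using Polynomial.induction_on' with
  | add p q hp hq => simp only [map_add, hp, hq, Polynomial.coeff_add, mul_add]
  | monomial i a =>
    rw [Polynomial.aeval_monomial, algebraMap_eq, ← smul_eq_C_mul, map_smul, smul_eval, h i,
      Polynomial.coeff_monomial]
    split_ifs <;> ring

theorem toFunction_normSqPoly {n : ℕ} (S : Finset (Idx n)) (x : CSpace n) :
    toFunction n (normSqPoly S) x = ((∑ i ∈ S, ‖x i‖ ^ 2 : ℝ) : ℂ) := by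
  simp [toFunction_apply, normSqPoly, Complex.mul_conj']

/-- A polynomial that is even on the real line is a polynomial in the square of the variable. -/
theorem exists_eq_expand_two {Φ : Polynomial ℂ}
    (h : ∀ t : ℝ, Φ.eval (t : ℂ) = Φ.eval (-t : ℂ)) :
    ∃ G : Polynomial ℂ, ∀ t : ℂ, Φ.eval t = G.eval (t ^ 2) := by
  have h1 : Φ = Φ.comp (Polynomial.C (-1) * Polynomial.X) := by
    refine Polynomial.eq_of_infinite_eval_eq _ _
      ((Set.infinite_range_of_injective Complex.ofReal_injective).mono ?_)
    rintro _ ⟨t, rfl⟩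
    simp [h t]
  have h2 : ∀ i, Odd i → Φ.coeff i = 0 := by
    intro i hi
    have := congrArg (fun q => Polynomial.coeff q i) h1
    simp only [Polynomial.comp_C_mul_X_coeff, hi.neg_one_pow, mul_neg_one] at this
    exact self_eq_neg.1 this
  refine ⟨Polynomial.contract 2 Φ, fun t => ?_⟩
  rw [← Polynomial.expand_eval]
  congr 1
  ext i
  rw [Polynomial.coeff_expand two_pos]
  split_ifs with hi
  · rw [Polynomial.coeff_contract two_ne_zero, Nat.div_mul_cancel hi]
  · exact h2 i (by rwa [← Nat.not_even_iff_odd, even_iff_two_dvd])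

/-- A harmonic polynomial invariant under `1 × Sp(n-1)` is determined by its restriction to the
first coordinate line. For fixed first coordinate it is a polynomial `G(ρ)` in the squared norm `ρ`
of the other coordinates, and the coefficients of `G` are, up to nonzero constants, the values
on the line of the powers of the Laplace operator in the other coordinates. By harmonicity these
are, up to sign, the powers of the Laplace operator of the line, applied to the restriction. -/
theorem eq_zero_of_firstLine_eq_zero {n k : ℕ} {hn : 2 ≤ n} {f : CSpace n → ℂ}
    (hf : f ∈ harmonic n k) (hK : f ∈ leftInvariants n hn)
    (h0 : ∀ a b, f (firstLine n hn a b) = 0) : f = 0 := by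
  obtain ⟨p, ⟨-, hp⟩, rfl⟩ := hf
  rw [SetLike.mem_coe, LinearMap.mem_ker] at hp
  set zi : Idx n := Sum.inl ⟨0, by omega⟩ with hzi
  set wi : Idx n := Sum.inr ⟨0, by omega⟩ with hwi
  set e : Idx n := Sum.inl ⟨1, by omega⟩ with he
  have hzw : zi ≠ wi := by simp [hzi, hwi]
  have hez : e ≠ zi := by simp [he, hzi]
  have hew : e ≠ wi := by simp [he, hwi]
  set S : Finset (Idx n) := {zi, wi} with hS
  have heS : e ∈ Sᶜ := by simp [hS, hez, hew]
  funext x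
  rw [Pi.zero_apply]
  -- the point of the first coordinate line below `x`
  set x₀ : CSpace n := firstLine n hn (x zi) (x wi) with hx₀
  have hx₀S : ∀ i ∈ S, x₀ i = x i := by
    intro i hi
    rw [hx₀, firstLine_eq]
    rcases Finset.mem_insert.1 hi with rfl | hi
    · simp [← hzi, ← hwi, hzw]
    · rw [Finset.mem_singleton.1 hi]; simp [← hzi, ← hwi, hzw.symm]
  have hx₀S' : ∀ i ∈ Sᶜ, x₀ i = 0 := by
    intro i hi
    have hi' : i ≠ zi ∧ i ≠ wi := by simpa [hS] using hi
    rw [hx₀, firstLine_eq]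
    simp [← hzi, ← hwi, hi'.1, hi'.2]
  have hpt : ∀ i, x₀ i = if i ∈ S then x i else 0 := by
    intro i
    split_ifs with hi
    · exact hx₀S i hi
    · exact hx₀S' i (Finset.mem_compl.2 hi)
  -- restriction to the first coordinate line
  let τ : Idx n ⊕ Idx n → ConjPoly n :=
    Sum.elim (fun i => if i ∈ S then X (Sum.inl i) else 0)
      (fun i => if i ∈ S then X (Sum.inr i) else 0)
  have hτl : ∀ i ∈ S, ∀ j, pderiv (Sum.inl i) (τ j) = if j = Sum.inl i then 1 else 0 := by
    rintro i hi (j | j)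
    · by_cases hj : j ∈ S
      · simp [τ, hj, pderiv_X, Pi.single_apply, eq_comm]
      · have : j ≠ i := fun h => hj (h ▸ hi)
        simp [τ, hj, this]
    · by_cases hj : j ∈ S <;> simp [τ, hj, pderiv_X]
  have hτr : ∀ i ∈ S, ∀ j, pderiv (Sum.inr i) (τ j) = if j = Sum.inr i then 1 else 0 := by
    rintro i hi (j | j)
    · by_cases hj : j ∈ S <;> simp [τ, hj, pderiv_X]
    · by_cases hj : j ∈ S
      · simp [τ, hj, pderiv_X, Pi.single_apply, eq_comm]
      · have : j ≠ i := fun h => hj (h ▸ hi)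
        simp [τ, hj, this]
  have hτp : aeval τ p = 0 := by
    apply toFunction_injective n
    funext y
    rw [toFunction_aeval, map_zero, Pi.zero_apply, ← h0 (y zi) (y wi), toFunction_apply]
    congr 2
    have hy : ∀ i, firstLine n hn (y zi) (y wi) i = if i ∈ S then y i else 0 := by
      intro i
      rw [firstLine_eq]
      by_cases h1 : i = zi
      · subst h1; simp [← hzi, ← hwi, hzw, hS]
      · by_cases h2 : i = wi
        · subst h2; simp [← hzi, ← hwi, hzw.symm, hS]
        · simp [← hzi, ← hwi, h1, h2, hS]
    funext j
    rcases j with j | j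
    · by_cases hj : j ∈ S <;> simp [τ, hj, hy, toFunction_apply]
    · by_cases hj : j ∈ S <;> simp [τ, hj, hy, toFunction_apply]
  -- the Laplace operator of the line commutes with the restriction `τ`
  have hD : ∀ m, eval (Sum.elim x₀ (star x₀)) ((partialLaplace Sᶜ ^ m) p) = 0 := by
    intro m
    have h1 : ∀ q : ConjPoly n, eval (Sum.elim x₀ (star x₀)) q =
        eval (Sum.elim x₀ (star x₀)) (aeval τ q) := by
      intro q
      rw [← coe_aeval_eq_eval, RingHom.coe_coe, ← AlgHom.comp_apply, comp_aeval]
      congr 2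
      funext j
      rcases j with j | j
      · by_cases hj : j ∈ S <;> simp [τ, hj, hpt]
      · by_cases hj : j ∈ S <;> simp [τ, hj, hpt]
    rw [pow_partialLaplace_compl S hp, smul_eval, h1, ← pow_partialLaplace_aeval τ hτl hτr, hτp]
    simp
  -- the polynomial in the last coordinates obtained by freezing the first ones
  let ψ : Idx n ⊕ Idx n → ConjPoly n :=
    Sum.elim (fun i => if i ∈ S then C (x i) else X (Sum.inl i))
      (fun i => if i ∈ S then C (star (x i)) else X (Sum.inr i))
  have hψl : ∀ i ∈ Sᶜ, ∀ j, pderiv (Sum.inl i) (ψ j) = if j = Sum.inl i then 1 else 0 := by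
    intro i hi j
    have hi := Finset.mem_compl.1 hi
    rcases j with j | j
    · by_cases hj : j ∈ S
      · have : j ≠ i := fun h => hi (h ▸ hj)
        simp [ψ, hj, this]
      · simp [ψ, hj, pderiv_X, Pi.single_apply, eq_comm]
    · by_cases hj : j ∈ S <;> simp [ψ, hj, pderiv_X]
  have hψr : ∀ i ∈ Sᶜ, ∀ j, pderiv (Sum.inr i) (ψ j) = if j = Sum.inr i then 1 else 0 := by
    intro i hi j
    have hi := Finset.mem_compl.1 hi
    rcases j with j | j
    · by_cases hj : j ∈ S <;> simp [ψ, hj, pderiv_X]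
    · by_cases hj : j ∈ S
      · have : j ≠ i := fun h => hi (h ▸ hj)
        simp [ψ, hj, this]
      · simp [ψ, hj, pderiv_X, Pi.single_apply, eq_comm]
  have hψD : ∀ m, eval (Sum.elim x₀ (star x₀)) ((partialLaplace Sᶜ ^ m) (aeval ψ p)) = 0 := by
    intro m
    rw [pow_partialLaplace_aeval ψ hψl hψr, ← hD m]
    rw [← coe_aeval_eq_eval, RingHom.coe_coe, ← AlgHom.comp_apply, comp_aeval]
    congr 2
    funext j
    rcases j with j | j
    · by_cases hj : j ∈ S <;> simp [ψ, hj, hpt]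
    · by_cases hj : j ∈ S <;> simp [ψ, hj, hpt]
  -- by transitivity, this polynomial is a polynomial in the squared norm
  have hψf : ∀ y : CSpace n, toFunction n (aeval ψ p) y =
      toFunction n p (fun i => if i ∈ S then x i else y i) := by
    intro y
    rw [toFunction_aeval, toFunction_apply n p]
    congr 2
    funext j
    rcases j with j | j
    · by_cases hj : j ∈ S <;> simp [ψ, hj, toFunction_apply]
    · by_cases hj : j ∈ S <;> simp [ψ, hj, toFunction_apply]
  have hrad : ∀ (y : CSpace n) (t : ℝ), t ^ 2 = ∑ i ∈ Sᶜ, ‖y i‖ ^ 2 →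
      toFunction n p (fun i => if i ∈ S then x i else y i) =
        toFunction n p (fun i => if i ∈ S then x i else (Pi.single e (t : ℂ) : CSpace n) i) := by
    intro y t ht
    refine leftInvariants_apply_eq hK ?_ ?_ ?_
    · rw [← Finset.sum_compl_add_sum S, ← Finset.sum_compl_add_sum S]
      refine congrArg₂ (· + ·) ?_ ?_
      · rw [Finset.sum_congr rfl (g := fun i => ‖y i‖ ^ 2) fun i hi => by
          rw [if_neg (Finset.mem_compl.1 hi)], ← ht]
        rw [Finset.sum_eq_single_of_mem e heS]
        · rw [if_neg (Finset.mem_compl.1 heS)]; simp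
        · intro i hi hie
          rw [if_neg (Finset.mem_compl.1 hi)]; simp [hie]
      · exact Finset.sum_congr rfl fun i hi => by rw [if_pos hi, if_pos hi]
    · rw [← hzi, if_pos (by simp [hS]), if_pos (by simp [hS])]
    · rw [← hwi, if_pos (by simp [hS]), if_pos (by simp [hS])]
  obtain ⟨Φ, hΦ⟩ : ∃ Φ : Polynomial ℂ, ∀ t : ℝ, Φ.eval (t : ℂ) =
      toFunction n p (fun i => if i ∈ S then x i else (Pi.single e (t : ℂ) : CSpace n) i) := by
    let g : Idx n ⊕ Idx n → Polynomial ℂ :=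
      Sum.elim (fun i => if i ∈ S then Polynomial.C (x i) else if i = e then Polynomial.X else 0)
        (fun i => if i ∈ S then Polynomial.C (star (x i)) else if i = e then Polynomial.X else 0)
    refine ⟨aeval g p, fun t => ?_⟩
    rw [toFunction_apply, ← Polynomial.coe_aeval_eq_eval, ← AlgHom.comp_apply, comp_aeval]
    congr 2
    funext j
    rcases j with j | j
    · by_cases hj : j ∈ S
      · simp [g, hj]
      · by_cases hje : j = e <;> simp [g, hj, hje, Finset.mem_compl.1 heS]
    · by_cases hj : j ∈ S
      · simp [g, hj]
      · by_cases hje : j = e <;> simp [g, hj, hje, Finset.mem_compl.1 heS]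
  obtain ⟨G, hG⟩ := exists_eq_expand_two (Φ := Φ) fun t => by
    rw [hΦ, ← Complex.ofReal_neg, hΦ]
    have h1 := hrad (Pi.single e (t : ℂ)) t (by
      rw [Finset.sum_eq_single_of_mem e heS]
      · simp
      · intro i _ hie; simp [hie])
    have h2 := hrad (Pi.single e (t : ℂ)) (-t) (by
      rw [Finset.sum_eq_single_of_mem e heS]
      · simp
      · intro i _ hie; simp [hie])
    rw [h2]
  have hψG : aeval ψ p = Polynomial.aeval (normSqPoly Sᶜ) G := by
    apply toFunction_injective n
    funext y
    have ht : Real.sqrt (∑ i ∈ Sᶜ, ‖y i‖ ^ 2) ^ 2 = ∑ i ∈ Sᶜ, ‖y i‖ ^ 2 :=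
      Real.sq_sqrt (Finset.sum_nonneg fun i _ => by positivity)
    rw [hψf, hrad y _ ht, ← hΦ, hG, ← Complex.ofReal_pow, ht, ← toFunction_normSqPoly]
    rw [toFunction_apply, toFunction_apply, ← Polynomial.aeval_algHom_apply,
      Polynomial.coe_aeval_eq_eval]
  have hG0 : G = 0 := by
    ext m
    obtain ⟨c, hc, h⟩ := exists_eval_pow_partialLaplace ⟨e, heS⟩ m
      (y := Sum.elim x₀ (star x₀)) (fun i hi => hx₀S' i hi)
    have := h G
    rw [← hψG, hψD] at this
    simpa [hc] using this.symm
  have := hψf x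
  rw [hψG, hG0, map_zero, map_zero, Pi.zero_apply] at this
  simpa using this.symm

open MeasureTheory

/-! ### Invariants from orthogonal complements -/

/-- The Hermitian form `∫ conj f * g` over the Euclidean unit ball of `ℂ²ⁿ`. The ball is taken in
`EuclideanSpace`, since `CSpace n` carries the sup norm. -/
noncomputable def ballInner {n : ℕ} (f g : CSpace n → ℂ) : ℂ :=
  ∫ x in Metric.closedBall (0 : EuclideanSpace ℂ (Idx n)) 1,
    star (f (WithLp.ofLp x)) * g (WithLp.ofLp x)

theorem continuous_ofLp_comp {n : ℕ} {f : CSpace n → ℂ} (hf : Continuous f) :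
    Continuous fun x : EuclideanSpace ℂ (Idx n) => f (WithLp.ofLp x) :=
  hf.comp (PiLp.continuous_ofLp 2 _)

theorem integrableOn_ball {n : ℕ} {f : EuclideanSpace ℂ (Idx n) → ℂ} (hf : Continuous f) :
    IntegrableOn f (Metric.closedBall (0 : EuclideanSpace ℂ (Idx n)) 1) :=
  hf.continuousOn.integrableOn_compact (isCompact_closedBall _ _)

theorem ballInner_mulVec {n : ℕ} {u : Matrix (Idx n) (Idx n) ℂ}
    (hu : u ∈ Matrix.unitaryGroup (Idx n) ℂ) (f g : CSpace n → ℂ) :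
    ballInner (fun x => f (u *ᵥ x)) (fun x => g (u *ᵥ x)) = ballInner f g := by
  let e := Unitary.linearIsometryEquiv
    (⟨Matrix.toEuclideanCLM (n := Idx n) (𝕜 := ℂ) u, Unitary.map_mem _ hu⟩ :
      unitary (EuclideanSpace ℂ (Idx n) →L[ℂ] EuclideanSpace ℂ (Idx n)))
  let e' : EuclideanSpace ℂ (Idx n) ≃ₗᵢ[ℝ] EuclideanSpace ℂ (Idx n) :=
    { e.toLinearEquiv.restrictScalars ℝ with norm_map' := e.norm_map }
  have he : ∀ x, WithLp.ofLp (e' x) = u *ᵥ WithLp.ofLp x := fun x => rfl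
  have hpre : e' ⁻¹' (Metric.closedBall 0 1) = Metric.closedBall 0 1 := by
    ext x; simp
  have := (e'.measurePreserving).setIntegral_preimage_emb
    e'.toHomeomorph.measurableEmbedding
    (fun x => star (f (WithLp.ofLp x)) * g (WithLp.ofLp x)) (Metric.closedBall 0 1)
  rw [hpre] at this
  rw [ballInner, ballInner, ← this]
  rfl

theorem eq_zero_of_ballInner_self {n : ℕ} {f : CSpace n → ℂ} (hf : Continuous f)
    (h : ballInner f f = 0) (x : EuclideanSpace ℂ (Idx n)) (hx : x ∈ Metric.ball 0 1) :
    f (WithLp.ofLp x) = 0 := by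
  have hc := continuous_ofLp_comp hf
  have h1 : ∫ x in Metric.closedBall (0 : EuclideanSpace ℂ (Idx n)) 1,
      ‖f (WithLp.ofLp x)‖ ^ 2 = 0 := by
    rw [← Complex.ofReal_eq_zero, ← h, ballInner, ← integral_complex_ofReal]
    refine integral_congr_ae (Filter.Eventually.of_forall fun x => ?_)
    simp [Complex.conj_mul']
  have hc2 : Continuous fun x : EuclideanSpace ℂ (Idx n) => ‖f (WithLp.ofLp x)‖ ^ 2 :=
    hc.norm.pow 2
  rw [integral_eq_zero_iff_of_nonneg (fun x => by positivity)
    (hc2.continuousOn.integrableOn_compact (isCompact_closedBall _ _))] at h1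
  have h2 := ae_restrict_of_ae_restrict_of_subset (Metric.ball_subset_closedBall) h1
  have h3 := Measure.eqOn_open_of_ae_eq h2 Metric.isOpen_ball
    hc2.continuousOn continuousOn_const hx
  simpa using h3

/-- `ballInner` is an inner product on a space of continuous functions in which a function that
vanishes on the unit ball is zero. -/
@[reducible]
noncomputable def ballInnerCore {n : ℕ} (V : Submodule ℂ (CSpace n → ℂ))
    (hV : ∀ f ∈ V, Continuous f)
    (hV' : ∀ f ∈ V, (∀ x ∈ Metric.ball (0 : EuclideanSpace ℂ (Idx n)) 1,
      f (WithLp.ofLp x) = 0) → f = 0) :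
    InnerProductSpace.Core ℂ V where
  inner f g := ballInner (f : CSpace n → ℂ) g
  conj_inner_symm f g := by
    rw [ballInner, ballInner, ← integral_conj]
    congr 1; funext x
    simp [mul_comm]
  re_inner_nonneg f := by
    have : ballInner (f : CSpace n → ℂ) f =
        ((∫ x in Metric.closedBall (0 : EuclideanSpace ℂ (Idx n)) 1,
          ‖(f : CSpace n → ℂ) (WithLp.ofLp x)‖ ^ 2 : ℝ) : ℂ) := by
      rw [ballInner, ← integral_complex_ofReal]
      congr 1; funext x
      simp [Complex.conj_mul']
    rw [this]
    exact integral_nonneg fun x => by positivity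
  add_left f g h := by
    have hf := continuous_ofLp_comp (hV f f.2)
    have hg := continuous_ofLp_comp (hV g g.2)
    have hh := continuous_ofLp_comp (hV h h.2)
    refine Eq.trans ?_ (integral_add
      (integrableOn_ball (hf.star.mul hh)) (integrableOn_ball (hg.star.mul hh)))
    rw [ballInner]
    congr 1; funext x
    simp [add_mul]
  smul_left f g c := by
    rw [ballInner, ballInner, ← integral_const_mul]
    congr 1; funext x
    simp [mul_assoc]
  definite f hf := Subtype.ext (hV' f f.2 (eq_zero_of_ballInner_self (hV f f.2) hf))

/-- If `R` is invariant under a set `T` of unitary matrices that is stable under inversion, then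
every `f` in `V` has the same image under `R` as some `T`-invariant element of `V`, namely as its
component `z` orthogonal to `ker R`: the difference of `z` and a translate of `z` lies in `ker R`,
and is orthogonal to it because the inner product is invariant. -/
theorem exists_invariant_of_invariant_map {n : ℕ} {V : Submodule ℂ (CSpace n → ℂ)}
    [FiniteDimensional ℂ V] (hV : ∀ f ∈ V, Continuous f)
    (hV' : ∀ f ∈ V, (∀ x ∈ Metric.ball (0 : EuclideanSpace ℂ (Idx n)) 1,
      f (WithLp.ofLp x) = 0) → f = 0)
    {T : Set (Matrix (Idx n) (Idx n) ℂ)} (hT : T ⊆ Matrix.unitaryGroup (Idx n) ℂ)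
    (hTinv : ∀ u ∈ T, u⁻¹ ∈ T) (hVT : ∀ u ∈ T, ∀ f ∈ V, leftAction n u f ∈ V)
    {W : Type*} [AddCommGroup W] [Module ℂ W] (R : (CSpace n → ℂ) →ₗ[ℂ] W)
    (hR : ∀ u ∈ T, ∀ f, R (leftAction n u f) = R f) {f : CSpace n → ℂ} (hf : f ∈ V) :
    ∃ f' ∈ V, R f' = R f ∧ ∀ u ∈ T, leftAction n u f' = f' := by
  let core := ballInnerCore V hV hV'
  let : NormedAddCommGroup V := core.toNormedAddCommGroup
  let : InnerProductSpace ℂ V := InnerProductSpace.ofCore core.toCore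
  have hinner : ∀ f g : V, inner ℂ f g = ballInner (f : CSpace n → ℂ) g := fun _ _ => rfl
  let U : Submodule ℂ V := LinearMap.ker (R ∘ₗ V.subtype)
  have hU : ∀ g : V, g ∈ U ↔ R g = 0 := fun g => LinearMap.mem_ker
  obtain ⟨y, hy, z, hz, hyz⟩ := U.exists_add_mem_mem_orthogonal (⟨f, hf⟩ : V)
  refine ⟨z, z.2, ?_, fun u hu => ?_⟩
  · have : f = y + z := congrArg Subtype.val hyz
    rw [this, map_add, (hU y).1 hy, zero_add]
  · have huinv : u * u⁻¹ = 1 := by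
      have h := Matrix.mem_unitaryGroup_iff.1 (hT hu)
      rwa [Matrix.inv_eq_right_inv h]
    let w : V := ⟨leftAction n u z, hVT u hu z z.2⟩
    have hw : w - z ∈ U := by
      rw [hU, Submodule.coe_sub, map_sub, hR u hu, sub_self]
    have hw' : w ∈ Uᗮ := by
      rw [Submodule.mem_orthogonal]
      intro g hg
      let g' : V := ⟨leftAction n u⁻¹ g, hVT _ (hTinv u hu) g g.2⟩
      have hg' : g' ∈ U := by
        rw [hU, ← (hU g).1 hg]; exact hR _ (hTinv u hu) g
      have h := (Submodule.mem_orthogonal U z).1 hz g' hg'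
      rw [hinner, ← ballInner_mulVec (hT (hTinv u hu))] at h
      rw [hinner, ← h]
      congr 1
      funext x
      have : (u⁻¹)⁻¹ *ᵥ u⁻¹ *ᵥ x = x := by
        rw [Matrix.mulVec_mulVec, Matrix.nonsing_inv_mul _
          (Matrix.isUnit_det_of_left_inverse huinv), Matrix.one_mulVec]
      exact (congrArg (g : CSpace n → ℂ) this).symm
    have h0 : w - z = 0 := by
      rw [← inner_self_eq_zero (𝕜 := ℂ)]
      exact (Submodule.mem_orthogonal U _).1 (Uᗮ.sub_mem hw' hz) _ hw
    exact congrArg Subtype.val (sub_eq_zero.1 h0)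

/-! ### The components consist of harmonic polynomials -/

theorem highestWeightVector_mem_harmonic (n : ℕ) (hn : 2 ≤ n) {α β γ : ℕ} (hγ : γ ≤ min α β) :
    highestWeightVector n hn α β γ ∈ harmonic n (α + β) := by
  let w₁ : ConjPoly n := X (Sum.inl (Sum.inr ⟨0, by omega⟩))
  let w₂ : ConjPoly n := X (Sum.inl (Sum.inr ⟨1, by omega⟩))
  let z₁ : ConjPoly n := X (Sum.inr (Sum.inl ⟨0, by omega⟩))
  let z₂ : ConjPoly n := X (Sum.inr (Sum.inl ⟨1, by omega⟩))
  refine ⟨w₁ ^ (α - γ) * z₁ ^ (β - γ) * (w₂ * z₁ - w₁ * z₂) ^ γ, ⟨?_, ?_⟩, ?_⟩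
  · have h1 : (w₁ ^ (α - γ)).IsHomogeneous (1 * (α - γ)) := (isHomogeneous_X _ _).pow _
    have h2 : (z₁ ^ (β - γ)).IsHomogeneous (1 * (β - γ)) := (isHomogeneous_X _ _).pow _
    have h3 : ((w₂ * z₁ - w₁ * z₂) ^ γ).IsHomogeneous (2 * γ) :=
      (((isHomogeneous_X _ _).mul (isHomogeneous_X _ _)).sub
        ((isHomogeneous_X _ _).mul (isHomogeneous_X _ _))).pow _
    have := (h1.mul h2).mul h3
    rw [show 1 * (α - γ) + 1 * (β - γ) + 2 * γ = α + β by omega] at this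
    exact this
  · rw [SetLike.mem_coe, LinearMap.mem_ker, laplace_apply]
    rw [Finset.sum_eq_zero, smul_zero]
    rintro (r | r) -
    · rw [pderiv_comm]
      have : pderiv (Sum.inl (Sum.inl r)) (w₁ ^ (α - γ) * z₁ ^ (β - γ) *
          (w₂ * z₁ - w₁ * z₂) ^ γ) = 0 := by
        simp [w₁, w₂, z₁, z₂, pderiv_X]
      rw [this, map_zero]
    · have : pderiv (Sum.inr (Sum.inr r)) (w₁ ^ (α - γ) * z₁ ^ (β - γ) *
          (w₂ * z₁ - w₁ * z₂) ^ γ) = 0 := by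
        simp [w₁, w₂, z₁, z₂, pderiv_X]
      rw [this, map_zero]
  · funext x
    simp [toFunction_apply, highestWeightVector, w₁, w₂, z₁, z₂]

theorem leftAction_mem_harmonic {n k : ℕ} {u : Matrix (Idx n) (Idx n) ℂ} (hu : u ∈ compactSp n)
    {f : CSpace n → ℂ} (hf : f ∈ harmonic n k) : leftAction n u f ∈ harmonic n k :=
  comp_mulVec_mem_harmonic (Matrix.mem_unitaryGroup_iff.1 (inv_mem_compactSp hu).1) hf

theorem component_le_harmonic (n : ℕ) (hn : 2 ≤ n) {α β γ : ℕ} (hγ : γ ≤ min α β) :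
    component n hn α β γ ≤ harmonic n (α + β) := by
  rw [component, Submodule.span_le]
  rintro _ ⟨u, hu, rfl⟩
  exact leftAction_mem_harmonic hu (highestWeightVector_mem_harmonic n hn hγ)

theorem leftAction_mem_component {n : ℕ} {hn : 2 ≤ n} {α β γ : ℕ} {u : Matrix (Idx n) (Idx n) ℂ}
    (hu : u ∈ compactSp n) {f : CSpace n → ℂ} (hf : f ∈ component n hn α β γ) :
    leftAction n u f ∈ component n hn α β γ := by
  induction hf using Submodule.span_induction with
  | mem f hf =>
    obtain ⟨v, hv, rfl⟩ := hf
    refine Submodule.subset_span ⟨u * v, mul_mem hu hv, ?_⟩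
    funext x
    simp only [leftAction]
    rw [Matrix.mulVec_mulVec, Matrix.mul_inv_rev]
  | zero => exact zero_mem _
  | add f g _ _ hf hg => exact add_mem hf hg
  | smul c f _ hf => exact Submodule.smul_mem _ c hf

/-! ### Restriction to the first coordinate line -/

/-- Restriction of functions to the first coordinate line `ℍ × 0` of `ℍⁿ`. -/
noncomputable def restrictLine (n : ℕ) (hn : 2 ≤ n) : (CSpace n → ℂ) →ₗ[ℂ] (CSpace 1 → ℂ) :=
  LinearMap.funLeft ℂ ℂ fun y => firstLine n hn (y (Sum.inl 0)) (y (Sum.inr 0))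

theorem restrictLine_apply {n : ℕ} (hn : 2 ≤ n) (f : CSpace n → ℂ) (y : CSpace 1) :
    restrictLine n hn f y = f (firstLine n hn (y (Sum.inl 0)) (y (Sum.inr 0))) := rfl

theorem eq_zero_of_restrictLine_eq_zero {n k : ℕ} {hn : 2 ≤ n} {f : CSpace n → ℂ}
    (hf : f ∈ harmonic n k) (hK : f ∈ leftInvariants n hn) (h0 : restrictLine n hn f = 0) :
    f = 0 :=
  eq_zero_of_firstLine_eq_zero hf hK fun a b =>
    congrFun h0 (Sum.elim (fun _ => a) (fun _ => b))

theorem inv_mem_subSp {n : ℕ} {hn : 2 ≤ n} {u : Matrix (Idx n) (Idx n) ℂ} (hu : u ∈ subSp n hn) :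
    u⁻¹ ∈ subSp n hn := by
  refine ⟨inv_mem_compactSp hu.1, fun i j hij => ?_⟩
  rw [inv_eq_star hu.1, Matrix.star_apply, hu.2 j i (by tauto), Matrix.one_apply, Matrix.one_apply]
  by_cases h : i = j
  · simp [h]
  · simp [h, Ne.symm h]

theorem mulVec_firstLine {n : ℕ} {hn : 2 ≤ n} {u : Matrix (Idx n) (Idx n) ℂ} (hu : u ∈ subSp n hn)
    (a b : ℂ) : u *ᵥ firstLine n hn a b = firstLine n hn a b := by
  rw [firstLine, mulVec_rightMul hu.1]
  congr 1
  funext i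
  rw [Matrix.mulVec_single_one, Matrix.col_apply, hu.2 _ _ (by simp), Matrix.one_apply,
    Pi.single_apply]

theorem restrictLine_leftAction {n : ℕ} {hn : 2 ≤ n} {u : Matrix (Idx n) (Idx n) ℂ}
    (hu : u ∈ subSp n hn) (f : CSpace n → ℂ) :
    restrictLine n hn (leftAction n u f) = restrictLine n hn f := by
  funext y
  rw [restrictLine_apply, restrictLine_apply, leftAction, mulVec_firstLine (inv_mem_subSp hu)]

/-- Restricted to the first coordinate line, the invariants of a component give everything that the
whole component gives. -/
theorem map_restrictLine_componentInvariants (n : ℕ) (hn : 2 ≤ n) {α β γ : ℕ} (hγ : γ ≤ min α β) :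
    (componentInvariants n hn α β γ).map (restrictLine n hn) =
      (component n hn α β γ).map (restrictLine n hn) := by
  refine le_antisymm (Submodule.map_mono inf_le_left) ?_
  rintro _ ⟨f, hf, rfl⟩
  have hle := component_le_harmonic n hn hγ
  have : FiniteDimensional ℂ (component n hn α β γ) := Submodule.finiteDimensional_of_le hle
  have hsep : ∀ f ∈ component n hn α β γ,
      (∀ x ∈ Metric.ball (0 : EuclideanSpace ℂ (Idx n)) 1, f (WithLp.ofLp x) = 0) → f = 0 := by
    intro f hf h
    funext x
    obtain ⟨t, ht, hx⟩ :
        ∃ t : ℝ, 0 < t ∧ ‖t • (WithLp.toLp 2 x : EuclideanSpace ℂ (Idx n))‖ < 1 := by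
      refine ⟨(‖(WithLp.toLp 2 x : EuclideanSpace ℂ (Idx n))‖ + 1)⁻¹, by positivity, ?_⟩
      rw [norm_smul, Real.norm_of_nonneg (by positivity), inv_mul_lt_iff₀ (by positivity)]
      linarith
    have h1 := h _ (mem_ball_zero_iff.2 hx)
    have h2 := harmonic_smul (hle hf) t x
    rw [WithLp.ofLp_smul] at h1
    rw [h1] at h2
    exact (mul_eq_zero.1 h2.symm).resolve_left
      (pow_ne_zero _ (Complex.ofReal_ne_zero.2 ht.ne'))
  obtain ⟨f', hf', hR, hinv⟩ := exists_invariant_of_invariant_map (V := component n hn α β γ)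
    (T := subSp n hn) (fun f hf => continuous_of_mem_harmonic (hle hf)) hsep (fun u hu => hu.1.1)
    (fun u hu => inv_mem_subSp hu) (fun u hu f hf => leftAction_mem_component hu.1 hf)
    (restrictLine n hn) (fun u hu f => restrictLine_leftAction hu f) hf
  exact ⟨f', ⟨hf', hinv⟩, hR⟩

theorem finrank_componentInvariants_eq (n : ℕ) (hn : 2 ≤ n) {α β γ : ℕ} (hγ : γ ≤ min α β) :
    Module.finrank ℂ (componentInvariants n hn α β γ) =
      Module.finrank ℂ ((component n hn α β γ).map (restrictLine n hn)) := by
  rw [← map_restrictLine_componentInvariants n hn hγ, ← LinearMap.range_domRestrict,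
    LinearMap.finrank_range_of_inj]
  rw [← LinearMap.ker_eq_bot, LinearMap.ker_eq_bot']
  intro f hf
  exact Subtype.ext (eq_zero_of_restrictLine_eq_zero (component_le_harmonic n hn hγ f.2.1) f.2.2 hf)

/-! ### The restriction of a component -/

/-- Right multiplication by `q = a + j b` acts linearly on `(w₁, conj z₁)`, and multiplies
`w₂ conj z₁ - w₁ conj z₂` by `|q|²`. -/
theorem highestWeightVector_rightMul (n : ℕ) (hn : 2 ≤ n) (α β γ : ℕ) (a b : ℂ) (x : CSpace n) :
    highestWeightVector n hn α β γ (rightMul n a b x) =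
      (a * x (Sum.inr ⟨0, by omega⟩) + b * star (x (Sum.inl ⟨0, by omega⟩))) ^ (α - γ) *
      (star a * star (x (Sum.inl ⟨0, by omega⟩)) - star b * x (Sum.inr ⟨0, by omega⟩)) ^ (β - γ) *
      ((a * star a + b * star b) *
        (x (Sum.inr ⟨1, by omega⟩) * star (x (Sum.inl ⟨0, by omega⟩)) -
          x (Sum.inr ⟨0, by omega⟩) * star (x (Sum.inl ⟨1, by omega⟩)))) ^ γ := by
  simp only [highestWeightVector, rightMul, Sum.elim_inl, Sum.elim_inr, star_sub, star_mul',
    star_star]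
  congr 2
  ring

/-- The polynomial `(z s + w) ^ m * (conj z - conj w s) ^ l` in the variable `s`, over the
polynomials on the line `ℍ` with coordinate `z + j w`. -/
noncomputable def lineGen (m l : ℕ) : Polynomial (ConjPoly 1) :=
  (Polynomial.C (X (Sum.inl (Sum.inl 0))) * Polynomial.X +
      Polynomial.C (X (Sum.inl (Sum.inr 0)))) ^ m *
    (Polynomial.C (-X (Sum.inr (Sum.inr 0))) * Polynomial.X +
      Polynomial.C (X (Sum.inr (Sum.inl 0)))) ^ l

theorem natDegree_lineGen_le (m l : ℕ) : (lineGen m l).natDegree ≤ m + l := by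
  refine Polynomial.natDegree_mul_le_of_le ?_ ?_
  · have := Polynomial.natDegree_pow_le_of_le m
      (Polynomial.natDegree_linear_le (a := (X (Sum.inl (Sum.inl 0)) : ConjPoly 1))
        (b := X (Sum.inl (Sum.inr 0))))
    rwa [mul_one] at this
  · have := Polynomial.natDegree_pow_le_of_le l
      (Polynomial.natDegree_linear_le (a := (-X (Sum.inr (Sum.inr 0)) : ConjPoly 1))
        (b := X (Sum.inr (Sum.inl 0))))
    rwa [mul_one] at this

theorem coeff_lineGen_top (m l : ℕ) : (lineGen m l).coeff (m + l) =
    X (Sum.inl (Sum.inl 0)) ^ m * (-X (Sum.inr (Sum.inr 0))) ^ l := by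
  have h : ∀ (a b : ConjPoly 1) (k : ℕ),
      ((Polynomial.C a * Polynomial.X + Polynomial.C b) ^ k).coeff k = a ^ k ∧
      ((Polynomial.C a * Polynomial.X + Polynomial.C b) ^ k).natDegree ≤ k := by
    intro a b k
    have h1 := Polynomial.coeff_pow_of_natDegree_le (m := k)
      (Polynomial.natDegree_linear_le (a := a) (b := b))
    have h2 := Polynomial.natDegree_pow_le_of_le k
      (Polynomial.natDegree_linear_le (a := a) (b := b))
    rw [mul_one] at h1 h2
    refine ⟨by rw [h1]; simp, h2⟩
  rw [lineGen, Polynomial.coeff_mul_add_eq_of_natDegree_le (h _ _ _).2 (h _ _ _).2,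
    (h _ _ _).1, (h _ _ _).1]

/-- The squared norm `z conj z + w conj w` on the line `ℍ`. -/
noncomputable def lineNormSq : ConjPoly 1 :=
  X (Sum.inl (Sum.inl 0)) * X (Sum.inr (Sum.inl 0)) +
    X (Sum.inl (Sum.inr 0)) * X (Sum.inr (Sum.inr 0))

/-- The map that sends `c` to the function `∑ c i * (coefficient of s ^ i in lineGen m l)`,
multiplied by `|h| ^ (2 γ)`. Its range is the restriction of a component to the first
coordinate line. -/
noncomputable def lineMap (m l γ : ℕ) : (Fin (m + l + 1) → ℂ) →ₗ[ℂ] (CSpace 1 → ℂ) :=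
  Fintype.linearCombination ℂ fun i : Fin (m + l + 1) =>
    toFunction 1 ((lineGen m l).coeff i * lineNormSq ^ γ)

theorem lineMap_injective (m l γ : ℕ) : Function.Injective (lineMap m l γ) := by
  rw [← LinearMap.ker_eq_bot, LinearMap.ker_eq_bot']
  intro c hc
  have h1 : (∑ i, c i • (lineGen m l).coeff (i : ℕ)) * lineNormSq ^ γ = 0 := by
    apply toFunction_injective 1
    rw [map_zero, ← hc, lineMap, Fintype.linearCombination_apply, Finset.sum_mul, map_sum]
    exact Finset.sum_congr rfl fun i _ => by rw [smul_mul_assoc, map_smul]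
  have h2 : lineNormSq ≠ 0 := by
    intro h
    have := congrArg (fun p => toFunction 1 p 1) h
    simp [lineNormSq, toFunction_apply] at this
  have h3 := (mul_eq_zero.1 h1).resolve_right (pow_ne_zero _ h2)
  -- the substitution `z ↦ X, w ↦ 1, conj z ↦ 1, conj w ↦ -X` turns both linear factors of `lineGen`
  -- into `X s + 1`; it kills `lineNormSq`, hence the division by it beforehand
  let φ : ConjPoly 1 →ₐ[ℂ] Polynomial ℂ := aeval
    (Sum.elim (Sum.elim (fun _ => Polynomial.X) (fun _ => 1))
      (Sum.elim (fun _ => 1) (fun _ => -Polynomial.X)))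
  have hφ : ∀ i : ℕ, φ ((lineGen m l).coeff i) =
      Polynomial.C (((m + l).choose i : ℕ) : ℂ) * Polynomial.X ^ i := by
    intro i
    have hmap : (lineGen m l).map (φ : ConjPoly 1 →+* Polynomial ℂ) =
        ((1 + Polynomial.X) ^ (m + l)).comp (Polynomial.C Polynomial.X * Polynomial.X) := by
      simp only [lineGen, Polynomial.map_mul, Polynomial.map_pow, Polynomial.map_add,
        Polynomial.map_C, Polynomial.map_X, pow_add]
      simp [φ, add_comm]
    have := congrArg (fun p => Polynomial.coeff p i) hmap
    simp only [Polynomial.coeff_map, Polynomial.comp_C_mul_X_coeff,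
      Polynomial.coeff_one_add_X_pow] at this
    rw [map_natCast]
    exact this
  have h4 := congrArg φ h3
  rw [map_sum, map_zero] at h4
  funext i
  have h5 := congrArg (fun p => Polynomial.coeff p (i : ℕ)) h4
  simp only [map_smul, hφ, Polynomial.finsetSum_coeff, Polynomial.coeff_smul,
    Polynomial.coeff_C_mul_X_pow, Polynomial.coeff_zero] at h5
  rw [Finset.sum_eq_single i] at h5
  · have : (m + l).choose i ≠ 0 := (Nat.choose_pos (Nat.lt_succ_iff.1 i.2)).ne'
    simpa [this] using h5
  · intro j _ hj
    rw [if_neg (fun h => hj (Fin.ext h.symm)), smul_zero]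
  · simp

/-- The function `(z s + w t) ^ m * (conj z t - conj w s) ^ l * |h| ^ (2 γ)` of `h = z + j w`; up to
a constant, every translate of the highest weight vector restricts to such a function. -/
noncomputable def lineFun (m l γ : ℕ) (s t : ℂ) : CSpace 1 → ℂ := fun y =>
  (y (Sum.inl 0) * s + y (Sum.inr 0) * t) ^ m *
    (star (y (Sum.inl 0)) * t - star (y (Sum.inr 0)) * s) ^ l *
    (y (Sum.inl 0) * star (y (Sum.inl 0)) + y (Sum.inr 0) * star (y (Sum.inr 0))) ^ γ

theorem lineFun_mul (m l γ : ℕ) (c s t : ℂ) :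
    lineFun m l γ (c * s) (c * t) = c ^ (m + l) • lineFun m l γ s t := by
  funext y
  have h1 : y (Sum.inl 0) * (c * s) + y (Sum.inr 0) * (c * t) =
      c * (y (Sum.inl 0) * s + y (Sum.inr 0) * t) := by ring
  have h2 : star (y (Sum.inl 0)) * (c * t) - star (y (Sum.inr 0)) * (c * s) =
      c * (star (y (Sum.inl 0)) * t - star (y (Sum.inr 0)) * s) := by ring
  rw [Pi.smul_apply, smul_eq_mul, lineFun, lineFun, h1, h2, mul_pow, mul_pow, pow_add]
  ring

theorem lineMap_pow (m l γ : ℕ) (s : ℂ) :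
    lineMap m l γ (fun i => s ^ (i : ℕ)) = lineFun m l γ s 1 := by
  funext y
  let φ : ConjPoly 1 →+* ℂ :=
    (aeval (Sum.elim y (star y) : Idx 1 ⊕ Idx 1 → ℂ) : ConjPoly 1 →ₐ[ℂ] ℂ)
  have hdeg : ((lineGen m l).map φ).natDegree < m + l + 1 :=
    Nat.lt_succ_iff.2 (Polynomial.natDegree_map_le.trans (natDegree_lineGen_le m l))
  have h := Polynomial.eval_eq_sum_range' hdeg s
  have hN : φ lineNormSq = y (Sum.inl 0) * star (y (Sum.inl 0)) +
      y (Sum.inr 0) * star (y (Sum.inr 0)) := by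
    simp [φ, lineNormSq]
  have hG : ((lineGen m l).map φ).eval s = (y (Sum.inl 0) * s + y (Sum.inr 0) * 1) ^ m *
      (star (y (Sum.inl 0)) * 1 - star (y (Sum.inr 0)) * s) ^ l := by
    simp [φ, lineGen, sub_eq_add_neg, add_comm]
  rw [lineMap, Fintype.linearCombination_apply, Finset.sum_apply, lineFun, ← hN, ← hG, h,
    Finset.sum_mul, Finset.sum_range]
  refine Finset.sum_congr rfl fun i _ => ?_
  have hi : toFunction 1 ((lineGen m l).coeff i * lineNormSq ^ γ) y =
      φ ((lineGen m l).coeff i * lineNormSq ^ γ) := rfl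
  rw [Pi.smul_apply, smul_eq_mul, hi, map_mul, map_pow, Polynomial.coeff_map]
  ring

theorem lineMap_single_last (m l γ : ℕ) (s : ℂ) :
    lineMap m l γ (Pi.single (Fin.last (m + l)) (s ^ (m + l))) = lineFun m l γ s 0 := by
  funext y
  rw [lineMap, Fintype.linearCombination_apply_single, Fin.val_last, coeff_lineGen_top]
  have h : star (y (Sum.inl 0)) * 0 - star (y (Sum.inr 0)) * s = -star (y (Sum.inr 0)) * s := by
    ring
  rw [lineFun, h, mul_zero, add_zero, mul_pow, mul_pow, pow_add]
  simp [toFunction_apply, lineNormSq]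
  ring

theorem lineFun_mem_range (m l γ : ℕ) (s t : ℂ) :
    lineFun m l γ s t ∈ LinearMap.range (lineMap m l γ) := by
  by_cases ht : t = 0
  · subst ht
    exact ⟨_, lineMap_single_last m l γ s⟩
  · refine ⟨t ^ (m + l) • fun i : Fin (m + l + 1) => (s / t) ^ (i : ℕ), ?_⟩
    rw [map_smul, lineMap_pow, ← lineFun_mul, mul_div_cancel₀ _ ht, mul_one]

theorem restrictLine_leftAction_highestWeightVector {n : ℕ} (hn : 2 ≤ n) (α β γ : ℕ)
    (u : Matrix (Idx n) (Idx n) ℂ) (hu : u ∈ compactSp n) {x : CSpace n}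
    (hx : x = u⁻¹ *ᵥ Pi.single (Sum.inl ⟨0, by omega⟩) 1) :
    restrictLine n hn (leftAction n u (highestWeightVector n hn α β γ)) =
      (x (Sum.inr ⟨1, by omega⟩) * star (x (Sum.inl ⟨0, by omega⟩)) -
          x (Sum.inr ⟨0, by omega⟩) * star (x (Sum.inl ⟨1, by omega⟩))) ^ γ •
        lineFun (α - γ) (β - γ) γ (x (Sum.inr ⟨0, by omega⟩))
          (star (x (Sum.inl ⟨0, by omega⟩))) := by
  funext y
  rw [restrictLine_apply, leftAction, firstLine, mulVec_rightMul (inv_mem_compactSp hu), ← hx,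
    highestWeightVector_rightMul, Pi.smul_apply, smul_eq_mul, lineFun, mul_pow]
  ring

/-- The factor `(w₂ conj z₁ - w₁ conj z₂) ^ γ` vanishes at the points of the first coordinate line,
so that one has to translate to a point off that line: a multiple of `z = (1, -s)`, `w = (s, 1)`. -/
theorem lineFun_natCast_mem {n : ℕ} (hn : 2 ≤ n) (α β γ : ℕ) (s : ℕ) :
    lineFun (α - γ) (β - γ) γ s 1 ∈ (component n hn α β γ).map (restrictLine n hn) := by
  set r : ℝ := (Real.sqrt (2 * (1 + s ^ 2)))⁻¹ with hr
  have hr0 : r ≠ 0 := inv_ne_zero (Real.sqrt_ne_zero'.2 (by positivity))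
  have hr2 : r ^ 2 * (2 * (1 + s ^ 2)) = 1 := by
    rw [hr, inv_pow, Real.sq_sqrt (by positivity)]
    exact inv_mul_cancel₀ (by positivity)
  let i0 : Fin n := ⟨0, by omega⟩
  let i1 : Fin n := ⟨1, by omega⟩
  have h01 : i1 ≠ i0 := by simp [i0, i1]
  let x : CSpace n := (r : ℂ) • Sum.elim (Pi.single i0 1 - Pi.single i1 (s : ℂ))
    (Pi.single i0 (s : ℂ) + Pi.single i1 1)
  have hz0 : x (Sum.inl i0) = r := by simp [x, h01.symm]
  have hz1 : x (Sum.inl i1) = - (r * s) := by simp [x, h01]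
  have hw0 : x (Sum.inr i0) = r * s := by simp [x, h01.symm]
  have hw1 : x (Sum.inr i1) = r := by simp [x, h01]
  have hnorm : ∑ i, ‖(Pi.single (Sum.inl i0) 1 : CSpace n) i‖ ^ 2 = ∑ i, ‖x i‖ ^ 2 := by
    rw [Finset.sum_eq_single (Sum.inl i0), Fintype.sum_sum_type,
      Finset.sum_eq_add_of_mem i0 i1 (Finset.mem_univ _) (Finset.mem_univ _) h01.symm,
      Finset.sum_eq_add_of_mem i0 i1 (Finset.mem_univ _) (Finset.mem_univ _) h01.symm,
      hz0, hz1, hw0, hw1]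
    · simp [mul_pow]
      linarith
    · intro j _ hj; simp [x, hj.1, hj.2]
    · intro j _ hj; simp [x, hj.1, hj.2]
    · intro j _ hj; simp [hj]
    · simp
  obtain ⟨v, hv, hvx, -⟩ := exists_compactSp_mulVec_eq hnorm
  have hvinv : (v⁻¹)⁻¹ = v := by
    rw [inv_eq_star (inv_mem_compactSp hv), inv_eq_star hv, star_star]
  have key := restrictLine_leftAction_highestWeightVector hn α β γ v⁻¹ (inv_mem_compactSp hv)
    (x := x) (by rw [hvinv, ← hvx])
  have hmem : restrictLine n hn (leftAction n v⁻¹ (highestWeightVector n hn α β γ)) ∈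
      (component n hn α β γ).map (restrictLine n hn) :=
    Submodule.mem_map_of_mem (Submodule.subset_span ⟨_, inv_mem_compactSp hv, rfl⟩)
  rw [key] at hmem
  change (x (Sum.inr i1) * star (x (Sum.inl i0)) - x (Sum.inr i0) * star (x (Sum.inl i1))) ^ γ •
    lineFun (α - γ) (β - γ) γ (x (Sum.inr i0)) (star (x (Sum.inl i0))) ∈ _ at hmem
  have hB :
      x (Sum.inr i1) * star (x (Sum.inl i0)) - x (Sum.inr i0) * star (x (Sum.inl i1)) ≠ 0 := by
    rw [hz0, hz1, hw0, hw1]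
    have : (r : ℂ) * star (r : ℂ) - r * s * star (-(r * s : ℂ)) =
        ((r ^ 2 * (1 + s ^ 2) : ℝ) : ℂ) := by
      simp; ring
    rw [this, Complex.ofReal_ne_zero]
    positivity
  have hscale : lineFun (α - γ) (β - γ) γ (x (Sum.inr i0)) (star (x (Sum.inl i0))) =
      (r : ℂ) ^ (α - γ + (β - γ)) • lineFun (α - γ) (β - γ) γ s 1 := by
    rw [← lineFun_mul, hz0, hw0, mul_one]
    simp
  rw [hscale] at hmem
  rwa [Submodule.smul_mem_iff _ (pow_ne_zero _ hB),
    Submodule.smul_mem_iff _ (pow_ne_zero _ (Complex.ofReal_ne_zero.2 hr0))] at hmem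

theorem map_restrictLine_component {n : ℕ} (hn : 2 ≤ n) (α β γ : ℕ) :
    (component n hn α β γ).map (restrictLine n hn) =
      LinearMap.range (lineMap (α - γ) (β - γ) γ) := by
  set m := α - γ
  set l := β - γ
  refine le_antisymm ?_ ?_
  · rw [component, Submodule.map_span_le]
    rintro _ ⟨u, hu, rfl⟩
    rw [restrictLine_leftAction_highestWeightVector hn α β γ u hu rfl]
    exact Submodule.smul_mem _ _ (lineFun_mem_range _ _ _ _ _)
  -- the vectors `(j ^ i)_i` span, by the nonvanishing of the Vandermonde determinant
  · have hvan : LinearIndependent ℂ fun (j : Fin (m + l + 1)) (i : Fin (m + l + 1)) =>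
        ((j : ℕ) : ℂ) ^ (i : ℕ) := by
      have := Matrix.linearIndependent_rows_of_det_ne_zero (A := Matrix.vandermonde
        fun j : Fin (m + l + 1) => ((j : ℕ) : ℂ)) (Matrix.det_vandermonde_ne_zero_iff.2
          fun i j h => Fin.ext (Nat.cast_injective h))
      exact this
    have htop := hvan.span_eq_top_of_card_eq_finrank (by simp)
    rw [LinearMap.range_eq_map, ← htop, Submodule.map_span_le]
    rintro _ ⟨j, rfl⟩
    rw [lineMap_pow]
    exact lineFun_natCast_mem hn α β γ j

theorem finrank_componentInvariants (n : ℕ) (hn : 2 ≤ n) {α β γ : ℕ} (hγ : γ ≤ min α β) :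
    Module.finrank ℂ (componentInvariants n hn α β γ) = (α - γ) + (β - γ) + 1 := by
  rw [finrank_componentInvariants_eq n hn hγ, map_restrictLine_component,
    LinearMap.finrank_range_of_inj (lineMap_injective _ _ _)]
  simp

/-! ### Bi-invariant polynomials -/

theorem exists_firstLine_eq_smul {n : ℕ} {hn : 2 ≤ n} (a b : ℂ) :
    ∃ (t : ℝ) (a' b' : ℂ), ‖a'‖ ^ 2 + ‖b'‖ ^ 2 = 1 ∧
      firstLine n hn a b = t • firstLine n hn a' b' := by
  set t := Real.sqrt (‖a‖ ^ 2 + ‖b‖ ^ 2) with ht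
  have ht2 : t ^ 2 = ‖a‖ ^ 2 + ‖b‖ ^ 2 := Real.sq_sqrt (by positivity)
  by_cases h0 : t = 0
  · have ha : a = 0 := by
      have : ‖a‖ ^ 2 = 0 := by nlinarith [sq_nonneg ‖a‖, sq_nonneg ‖b‖]
      simpa using this
    have hb : b = 0 := by
      have : ‖b‖ ^ 2 = 0 := by nlinarith [sq_nonneg ‖a‖, sq_nonneg ‖b‖]
      simpa using this
    refine ⟨0, 1, 0, by simp, ?_⟩
    rw [firstLine_eq, ha, hb]; simp
  · refine ⟨t, a / t, b / t, ?_, ?_⟩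
    · rw [norm_div, norm_div, Complex.norm_real, Real.norm_eq_abs, div_pow, div_pow, sq_abs,
        ← add_div, ht2, div_self (by rw [← ht2]; exact pow_ne_zero _ h0)]
    · have h0' : (t : ℂ) ≠ 0 := Complex.ofReal_ne_zero.2 h0
      rw [firstLine_eq, firstLine_eq, smul_add, ← Pi.single_smul, ← Pi.single_smul]
      simp [mul_div_cancel₀ _ h0']

/-- `Sp(1)` and the dilations act transitively on the first coordinate line minus its origin, so
that a bi-invariant harmonic polynomial is determined by its value at one point. -/
theorem eq_zero_of_mem_biInvariants {n k : ℕ} {hn : 2 ≤ n} {f : CSpace n → ℂ}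
    (hf : f ∈ biInvariants n hn k) (h0 : f (Pi.single (Sum.inl ⟨0, by omega⟩) 1) = 0) : f = 0 := by
  obtain ⟨⟨hf, hl⟩, hr⟩ := hf
  refine eq_zero_of_firstLine_eq_zero hf hl fun a b => ?_
  obtain ⟨t, a', b', hab, h⟩ := exists_firstLine_eq_smul (hn := hn) a b
  have h1 : f (firstLine n hn a' b') = f (Pi.single (Sum.inl ⟨0, by omega⟩) 1) :=
    congrFun (hr a' b' hab) _
  rw [h, harmonic_smul hf, h1, h0, mul_zero]

/-- The unit quaternion `-1` acts on homogeneous polynomials of degree `k` by `(-1) ^ k`. -/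
theorem even_of_mem_biInvariants {n k : ℕ} {hn : 2 ≤ n} {f : CSpace n → ℂ}
    (hf : f ∈ biInvariants n hn k) (h0 : f ≠ 0) : Even k := by
  have h1 : f (Pi.single (Sum.inl ⟨0, by omega⟩) 1) ≠ 0 := fun h =>
    h0 (eq_zero_of_mem_biInvariants hf h)
  obtain ⟨⟨hf, -⟩, hr⟩ := hf
  set e : CSpace n := Pi.single (Sum.inl ⟨0, by omega⟩) 1
  have h2 := congrFun (hr (-1) 0 (by simp)) e
  have h3 : rightMul n (-1) 0 e = (-1 : ℝ) • e := by
    rw [rightMul_eq]; simp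
  rw [rightAction, h3, harmonic_smul hf] at h2
  by_contra hk
  rw [Nat.not_even_iff_odd] at hk
  rw [Complex.ofReal_neg, Complex.ofReal_one, hk.neg_one_pow, neg_one_mul] at h2
  exact h1 (self_eq_neg.1 h2.symm)

/-- For `α = β = γ` the highest weight vector is a power of `w₂ conj z₁ - w₁ conj z₂`, which right
multiplication by a quaternion multiplies by the squared norm of the quaternion. -/
theorem component_le_rightInvariants (n : ℕ) (hn : 2 ≤ n) (α : ℕ) :
    component n hn α α α ≤ rightInvariants n := by
  rw [component, Submodule.span_le]
  rintro _ ⟨u, hu, rfl⟩ a b hab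
  funext x
  have hab' : a * star a + b * star b = 1 := by
    rw [RCLike.star_def, Complex.mul_conj', Complex.mul_conj']
    exact_mod_cast hab
  rw [rightAction, leftAction, leftAction, mulVec_rightMul (inv_mem_compactSp hu),
    highestWeightVector_rightMul, hab']
  simp [highestWeightVector]

end QuatHarm

theorem proposition3 (n : ℕ) (hn : 2 ≤ n) :
    (∀ α β γ : ℕ, γ ≤ min α β →
      (Module.finrank ℂ (QuatHarm.componentInvariants n hn α β γ) : ℤ)
          = (α : ℤ) + (β : ℤ) - 2 * (γ : ℤ) + 1 ∧
        1 ≤ Module.finrank ℂ (QuatHarm.componentInvariants n hn α β γ) ∧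
        (Module.finrank ℂ (QuatHarm.componentInvariants n hn α β γ) = 1 ↔ α = β ∧ β = γ)) ∧
    (∀ k : ℕ,
      ((∃ P ∈ QuatHarm.biInvariants n hn k, P ≠ 0) → Even k) ∧
      (Even k →
        ∃ P ∈ QuatHarm.biInvariants n hn k,
          P ≠ 0 ∧
          P ∈ QuatHarm.component n hn (k / 2) (k / 2) (k / 2) ∧
          ∀ Q ∈ QuatHarm.biInvariants n hn k, ∃ c : ℂ, Q = c • P)) := by
  refine ⟨fun α β γ hγ => ?_, fun k => ⟨?_, ?_⟩⟩
  · rw [QuatHarm.finrank_componentInvariants n hn hγ]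
    omega
  · rintro ⟨P, hP, hP0⟩
    exact QuatHarm.even_of_mem_biInvariants hP hP0
  · rintro ⟨α, rfl⟩
    rw [show (α + α) / 2 = α by omega]
    have hfin := QuatHarm.finrank_componentInvariants n hn
      (show α ≤ min α α by simp)
    have : Nontrivial (QuatHarm.componentInvariants n hn α α α) :=
      Module.nontrivial_of_finrank_pos (R := ℂ) (by rw [hfin]; omega)
    obtain ⟨⟨P, hPc, hPl⟩, hP0⟩ := exists_ne (0 : QuatHarm.componentInvariants n hn α α α)
    have hP0 : P ≠ 0 := fun h => hP0 (Subtype.ext h)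
    have hP : P ∈ QuatHarm.biInvariants n hn (α + α) :=
      ⟨⟨QuatHarm.component_le_harmonic n hn (by simp) hPc, hPl⟩,
        QuatHarm.component_le_rightInvariants n hn α hPc⟩
    refine ⟨P, hP, hP0, hPc, fun Q hQ => ?_⟩
    set e : QuatHarm.CSpace n := Pi.single (Sum.inl ⟨0, by omega⟩) 1
    have hPe : P e ≠ 0 := fun h => hP0 (QuatHarm.eq_zero_of_mem_biInvariants hP h)
    refine ⟨Q e / P e, sub_eq_zero.1 (QuatHarm.eq_zero_of_mem_biInvariants
      (Submodule.sub_mem _ hQ (Submodule.smul_mem _ _ hP)) ?_)⟩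
    change Q e - Q e / P e * P e = 0
    rw [div_mul_cancel₀ _ hPe, sub_self]
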